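/- Let $\mathcal{H}_1,\mathcal{H}_2$ be separable complex Hilbert spaces, and let $\rho$ be a state (positive trace class operator of trace one) on the Hilbert space tensor product $\mathcal{H}_1\otimes\mathcal{H}_2$. Call a self-adjoint trace class operator $T$ a source-operator for $\rho$ if either $T$ acts on $\mathcal{H}_1\otimes\mathcal{H}_2\otimes\mathcal{H}_2$ and its partial traces over the second and over the third tensor factor are both equal to $\rho$, or $T$ acts on $\mathcal{H}_1\otimes\mathcal{H}_1\otimes\mathcal{H}_2$ and its partial traces over the first and over the second tensor factor are both equal to $\rho$. The state $\rho$ is called a density source-operator (DSO) state if it has a source-operator $T\ge 0$. Let $\rho$ be a DSO state. For $n,m\in\{1,2\}$ let $\Lambda_1^{(n)},\Lambda_2^{(m)}\subseteq[-1,1]$ be outcome sets, let $M_1^{(a_n)}$ be a normalized positive operator-valued measure (POVM) on $\Lambda_1^{(n)}$ with values in the bounded operators on $\mathcal{H}_1$ (measurements of Alice), and let $M_2^{(b_m)}$ be a normalized POVM on $\Lambda_2^{(m)}$ with values in the bounded operators on $\mathcal{H}_2$ (measurements of Bob). The joint measurement of Alice and Bob with settings $(a_n,b_m)$ is described by the POVM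 $M^{(a_n,b_m)}$ on $\Lambda_1^{(n)}\times\Lambda_2^{(m)}$ with $M^{(a_n,b_m)}(B_1\times B_2)=M_1^{(a_n)}(B_1)\otimes M_2^{(b_m)}(B_2)$ for all measurable $B_1,B_2$, and the expectation value of the product of the outcomes is $$\langle\lambda_1\lambda_2\rangle_\rho^{(a_n,b_m)}=\int_{\Lambda_1^{(n)}\times\Lambda_2^{(m)}}\lambda_1\lambda_2\,\mathrm{tr}\bigl[\rho\,M^{(a_n,b_m)}(d\lambda_1\times d\lambda_2)\bigr].$$ Then $$\Bigl|\langle\lambda_1\lambda_2\rangle_\rho^{(a_1,b_1)}+\langle\lambda_1\lambda_2\rangle_\rho^{(a_1,b_2)}+\langle\lambda_1\lambda_2\rangle_\rho^{(a_2,b_1)}-\langle\lambda_1\lambda_2\rangle_\rho^{(a_2,b_2)}\Bigr|\le 2.$$ -/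

import Mathlib

open scoped TensorProduct InnerProductSpace
open MeasureTheory

/-! ### Hilbert space tensor products -/

/-- The Hilbert space tensor product `H₁ ⊗ H₂`: the completion of the algebraic tensor product
for the inner product `⟪x₁ ⊗ y₁, x₂ ⊗ y₂⟫ = ⟪x₁, x₂⟫ ⟪y₁, y₂⟫`. -/
abbrev HilbertTensor (H₁ H₂ : Type*) [NormedAddCommGroup H₁] [InnerProductSpace ℂ H₁]
    [NormedAddCommGroup H₂] [InnerProductSpace ℂ H₂] : Type _ :=
  UniformSpace.Completion (H₁ ⊗[ℂ] H₂)

/-- The elementary tensor `x ⊗ y` in the Hilbert space tensor product. -/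
noncomputable def pureTensor {H₁ H₂ : Type*} [NormedAddCommGroup H₁] [InnerProductSpace ℂ H₁]
    [NormedAddCommGroup H₂] [InnerProductSpace ℂ H₂] (x : H₁) (y : H₂) : HilbertTensor H₁ H₂ :=
  ((x ⊗ₜ[ℂ] y : H₁ ⊗[ℂ] H₂) : UniformSpace.Completion (H₁ ⊗[ℂ] H₂))

/-- The tensor product `A ⊗ B` of bounded operators: the bounded operator on `H₁ ⊗ H₂` with
`(A ⊗ B) (x ⊗ y) = A x ⊗ B y`. -/
noncomputable def opTensor {H₁ H₂ : Type*} [NormedAddCommGroup H₁] [InnerProductSpace ℂ H₁]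
    [NormedAddCommGroup H₂] [InnerProductSpace ℂ H₂] (A : H₁ →L[ℂ] H₁) (B : H₂ →L[ℂ] H₂) :
    HilbertTensor H₁ H₂ →L[ℂ] HilbertTensor H₁ H₂ :=
  (TensorProduct.mapL A B).completion

theorem opTensor_pureTensor {H₁ H₂ : Type*} [NormedAddCommGroup H₁] [InnerProductSpace ℂ H₁]
    [NormedAddCommGroup H₂] [InnerProductSpace ℂ H₂] (A : H₁ →L[ℂ] H₁) (B : H₂ →L[ℂ] H₂)
    (x : H₁) (y : H₂) : opTensor A B (pureTensor x y) = pureTensor (A x) (B y) := by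
  simp [opTensor, pureTensor]

/-! ### Trace class operators, traces and density operators -/

section Trace

variable {H : Type*} [NormedAddCommGroup H] [InnerProductSpace ℂ H] [CompleteSpace H]

variable (H) in
/-- The index set of a fixed orthonormal (Hilbert) basis of `H`. -/
def basisIndex : Set H := (exists_hilbertBasis ℂ H).choose

variable (H) in
/-- A fixed orthonormal (Hilbert) basis of `H`. Traces and partial traces of trace class operators
do not depend on this choice. -/
noncomputable def stdBasis : HilbertBasis (basisIndex H) ℂ H :=
  (exists_hilbertBasis ℂ H).choose_spec.choose

/-- `T` is of trace class: `tr |T| < ∞`, where `|T| = (T† T)^(1/2)`. -/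
def IsTraceClass (T : H →L[ℂ] H) : Prop :=
  Summable fun i => ⟪stdBasis H i, CFC.abs T (stdBasis H i)⟫_ℂ

/-- The trace of a (trace class) operator. -/
noncomputable def trace (T : H →L[ℂ] H) : ℂ :=
  ∑' i, ⟪stdBasis H i, T (stdBasis H i)⟫_ℂ

variable (H) in
/-- A (normal) quantum state: a positive trace class operator of trace one. -/
structure DensityOperator where
  op : H →L[ℂ] H
  isPositive : op.IsPositive
  isTraceClass : IsTraceClass op
  trace_eq_one : trace op = 1

namespace DensityOperator

variable (ρ : DensityOperator H)

noncomputable def sqrtOp : H →L[ℂ] H := CFC.sqrt ρ.op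

theorem sqrtOp_sqrtOp (x : H) : ρ.sqrtOp (ρ.sqrtOp x) = ρ.op x := by
  have h : (0 : H →L[ℂ] H) ≤ ρ.op :=
    (ContinuousLinearMap.nonneg_iff_isPositive _).2 ρ.isPositive
  exact congrArg (fun A : H →L[ℂ] H => A x) (CFC.sqrt_mul_sqrt_self ρ.op h)

theorem inner_sqrtOp_left (x y : H) : ⟪ρ.sqrtOp x, y⟫_ℂ = ⟪x, ρ.sqrtOp y⟫_ℂ := by
  have h : ρ.sqrtOp.IsPositive :=
    (ContinuousLinearMap.nonneg_iff_isPositive _).1 (CFC.sqrt_nonneg ρ.op)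
  exact h.isSymmetric x y

theorem summable_norm_sqrtOp_sq :
    Summable fun i => ‖ρ.sqrtOp (stdBasis H i)‖ ^ 2 := by
  have h : (0 : H →L[ℂ] H) ≤ ρ.op :=
    (ContinuousLinearMap.nonneg_iff_isPositive _).2 ρ.isPositive
  have hs := ρ.isTraceClass
  rw [IsTraceClass, CFC.abs_of_nonneg ρ.op h] at hs
  have := Complex.reCLM.summable hs
  refine this.congr fun i => ?_
  rw [← ρ.sqrtOp_sqrtOp, ← inner_sqrtOp_left]
  simp [← inner_self_eq_norm_sq (𝕜 := ℂ)]

/-- `tr[ρ A] = tr[ρ^(1/2) A ρ^(1/2)]` for a state `ρ` and a bounded operator `A`. -/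
theorem hasSum_sqrtOp (A : H →L[ℂ] H) :
    HasSum (fun i => ⟪ρ.sqrtOp (stdBasis H i), A (ρ.sqrtOp (stdBasis H i))⟫_ℂ)
      (trace (ρ.op ∘L A)) := by
  set e := stdBasis H
  set S := ρ.sqrtOp
  let f : basisIndex H × basisIndex H → ℂ :=
    fun p => ⟪S (e p.1), e p.2⟫_ℂ * ⟪e p.2, S (A (e p.1))⟫_ℂ
  have parseval (x : H) : HasSum (fun j => ‖⟪x, e j⟫_ℂ‖ ^ 2) (‖x‖ ^ 2) := by
    have := Complex.reCLM.hasSum (e.hasSum_inner_mul_inner x x)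
    convert this using 1
    · ext j
      rw [← inner_conj_symm (e j) x, Complex.mul_conj']
      norm_cast
    · simp [← inner_self_eq_norm_sq (𝕜 := ℂ)]
  have prodSum (g : basisIndex H → H) (hg : Summable fun i => ‖g i‖ ^ 2) :
      Summable fun p : basisIndex H × basisIndex H => ‖⟪g p.1, e p.2⟫_ℂ‖ ^ 2 := by
    rw [summable_prod_of_nonneg (fun _ => by positivity)]
    exact ⟨fun i => (parseval (g i)).summable, by simpa [(parseval _).tsum_eq] using hg⟩
  have h₁ := prodSum (fun i => S (e i)) ρ.summable_norm_sqrtOp_sq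
  have h₂ : Summable fun i => ‖A.adjoint (S (e i))‖ ^ 2 := by
    refine Summable.of_nonneg_of_le (fun _ => by positivity) (fun i => ?_)
      (ρ.summable_norm_sqrtOp_sq.mul_left (‖A.adjoint‖ ^ 2))
    rw [← mul_pow]
    gcongr
    exact A.adjoint.le_opNorm _
  have h₃ := (Equiv.prodComm _ _).summable_iff.2 (prodSum _ h₂)
  have eq₂ (i j : basisIndex H) :
      ⟪e j, S (A (e i))⟫_ℂ = ⟪A.adjoint (S (e j)), e i⟫_ℂ := by
    rw [ContinuousLinearMap.adjoint_inner_left, ρ.inner_sqrtOp_left]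
  have hf : Summable f := by
    refine Summable.of_norm_bounded ((h₁.add h₃).mul_left (1 / 2)) fun p => ?_
    simp only [f, norm_mul, eq₂, Function.comp_apply, Equiv.prodComm_apply, Prod.fst_swap,
      Prod.snd_swap]
    nlinarith [sq_nonneg (‖⟪S (e p.1), e p.2⟫_ℂ‖ - ‖⟪A.adjoint (S (e p.2)), e p.1⟫_ℂ‖)]
  have hrow (i : basisIndex H) : HasSum (fun j => f (i, j)) ⟪e i, (ρ.op ∘L A) (e i)⟫_ℂ := by
    have := e.hasSum_inner_mul_inner (S (e i)) (S (A (e i)))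
    rwa [ρ.inner_sqrtOp_left, ρ.sqrtOp_sqrtOp] at this
  have hcol (j : basisIndex H) : HasSum (fun i => f (i, j)) ⟪S (e j), A (S (e j))⟫_ℂ := by
    have := e.hasSum_inner_mul_inner (A.adjoint (S (e j))) (S (e j))
    rw [ContinuousLinearMap.adjoint_inner_left] at this
    refine this.congr_fun fun i => ?_
    simp only [f]
    rw [eq₂, ρ.inner_sqrtOp_left, ← ρ.inner_sqrtOp_left, mul_comm]
  have htr : ∑' p, f p = trace (ρ.op ∘L A) :=
    (hf.hasSum.prod_fiberwise hrow).tsum_eq.symm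
  rw [← htr]
  have := ((Equiv.prodComm _ _).hasSum_iff.2 hf.hasSum)
  exact this.prod_fiberwise hcol

end DensityOperator

end Trace

/-! ### Partial traces, source-operators and DSO states -/

section PartialTrace

variable {H K L : Type*} [NormedAddCommGroup H] [InnerProductSpace ℂ H] [CompleteSpace H]
  [NormedAddCommGroup K] [InnerProductSpace ℂ K] [NormedAddCommGroup L] [InnerProductSpace ℂ L]

/-- `σ` on `K ⊗ L` is the partial trace of `T` on `H ⊗ K ⊗ L` over the first factor:
`⟪x ⊗ y, σ (x' ⊗ y')⟫ = ∑ᵢ ⟪eᵢ ⊗ x ⊗ y, T (eᵢ ⊗ x' ⊗ y')⟫` for an orthonormal basis `(eᵢ)` of `H`.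
This determines the bounded operator `σ` uniquely. -/
def IsPartialTraceFirst
    (T : HilbertTensor H (HilbertTensor K L) →L[ℂ] HilbertTensor H (HilbertTensor K L))
    (σ : HilbertTensor K L →L[ℂ] HilbertTensor K L) : Prop :=
  ∀ (x x' : K) (y y' : L),
    HasSum (fun i => ⟪pureTensor (stdBasis H i) (pureTensor x y),
        T (pureTensor (stdBasis H i) (pureTensor x' y'))⟫_ℂ)
      ⟪pureTensor x y, σ (pureTensor x' y')⟫_ℂ

/-- `σ` on `K ⊗ L` is the partial trace of `T` on `K ⊗ H ⊗ L` over the second factor. -/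
def IsPartialTraceSecond
    (T : HilbertTensor K (HilbertTensor H L) →L[ℂ] HilbertTensor K (HilbertTensor H L))
    (σ : HilbertTensor K L →L[ℂ] HilbertTensor K L) : Prop :=
  ∀ (x x' : K) (y y' : L),
    HasSum (fun i => ⟪pureTensor x (pureTensor (stdBasis H i) y),
        T (pureTensor x' (pureTensor (stdBasis H i) y'))⟫_ℂ)
      ⟪pureTensor x y, σ (pureTensor x' y')⟫_ℂ

/-- `σ` on `K ⊗ L` is the partial trace of `T` on `K ⊗ L ⊗ H` over the third factor. -/
def IsPartialTraceThird
    (T : HilbertTensor K (HilbertTensor L H) →L[ℂ] HilbertTensor K (HilbertTensor L H))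
    (σ : HilbertTensor K L →L[ℂ] HilbertTensor K L) : Prop :=
  ∀ (x x' : K) (y y' : L),
    HasSum (fun i => ⟪pureTensor x (pureTensor y (stdBasis H i)),
        T (pureTensor x' (pureTensor y' (stdBasis H i)))⟫_ℂ)
      ⟪pureTensor x y, σ (pureTensor x' y')⟫_ℂ

end PartialTrace

section SourceOperators

variable {H₁ H₂ : Type*} [NormedAddCommGroup H₁] [InnerProductSpace ℂ H₁] [CompleteSpace H₁]
  [NormedAddCommGroup H₂] [InnerProductSpace ℂ H₂] [CompleteSpace H₂]

/-- `T` is a source-operator on `H₁ ⊗ H₁ ⊗ H₂` for the state `ρ` on `H₁ ⊗ H₂`. -/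
structure IsSourceOperator112 (ρ : DensityOperator (HilbertTensor H₁ H₂))
    (T : HilbertTensor H₁ (HilbertTensor H₁ H₂) →L[ℂ] HilbertTensor H₁ (HilbertTensor H₁ H₂)) :
    Prop where
  isSelfAdjoint : IsSelfAdjoint T
  isTraceClass : IsTraceClass T
  partialTrace_first : IsPartialTraceFirst T ρ.op
  partialTrace_second : IsPartialTraceSecond T ρ.op

/-- `T` is a source-operator on `H₁ ⊗ H₂ ⊗ H₂` for the state `ρ` on `H₁ ⊗ H₂`. -/
structure IsSourceOperator122 (ρ : DensityOperator (HilbertTensor H₁ H₂))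
    (T : HilbertTensor H₁ (HilbertTensor H₂ H₂) →L[ℂ] HilbertTensor H₁ (HilbertTensor H₂ H₂)) :
    Prop where
  isSelfAdjoint : IsSelfAdjoint T
  isTraceClass : IsTraceClass T
  partialTrace_second : IsPartialTraceSecond T ρ.op
  partialTrace_third : IsPartialTraceThird T ρ.op

/-- `ρ` is a density source-operator (DSO) state: it has a positive source-operator, on
`H₁ ⊗ H₁ ⊗ H₂` or on `H₁ ⊗ H₂ ⊗ H₂`. -/
def IsDSOState (ρ : DensityOperator (HilbertTensor H₁ H₂)) : Prop :=
  (∃ T : HilbertTensor H₁ (HilbertTensor H₁ H₂) →L[ℂ] HilbertTensor H₁ (HilbertTensor H₁ H₂),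
      IsSourceOperator112 ρ T ∧ T.IsPositive) ∨
    ∃ T : HilbertTensor H₁ (HilbertTensor H₂ H₂) →L[ℂ] HilbertTensor H₁ (HilbertTensor H₂ H₂),
      IsSourceOperator122 ρ T ∧ T.IsPositive

end SourceOperators

/-! ### Generalized measurements -/

/-- A (normalized) positive operator-valued measure on the outcome space `Ω`, with values in the
bounded operators on `H`. The values on non-measurable sets are irrelevant. -/
structure POVM (Ω : Type*) [MeasurableSpace Ω] (H : Type*) [NormedAddCommGroup H]
    [InnerProductSpace ℂ H] where
  effect : Set Ω → H →L[ℂ] H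
  isPositive : ∀ B, MeasurableSet B → (effect B).IsPositive
  effect_univ : effect Set.univ = 1
  hasSum_effect : ∀ B : ℕ → Set Ω, (∀ n, MeasurableSet (B n)) →
    Pairwise (Function.onFun Disjoint B) →
    ∀ x y : H, HasSum (fun n => ⟪x, effect (B n) y⟫_ℂ) ⟪x, effect (⋃ n, B n) y⟫_ℂ

namespace POVM

section Law

variable {Ω : Type*} [MeasurableSpace Ω] {H : Type*} [NormedAddCommGroup H]
  [InnerProductSpace ℂ H]

theorem inner_effect_empty (M : POVM Ω H) (x y : H) : ⟪x, M.effect ∅ y⟫_ℂ = 0 := by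
  have h := M.hasSum_effect (fun _ => ∅) (fun _ => MeasurableSet.empty)
    (fun _ _ _ => disjoint_bot_left) x y
  exact (summable_const_iff _).1 h.summable

theorem re_inner_effect_nonneg (M : POVM Ω H) {B : Set Ω} (hB : MeasurableSet B) (x : H) :
    0 ≤ (⟪x, M.effect B x⟫_ℂ).re :=
  (M.isPositive B hB).re_inner_nonneg_right x

variable [CompleteSpace H] (ρ : DensityOperator H) (M : POVM Ω H)

theorem hasSum_re_sqrtOp {B : Set Ω} :
    HasSum (fun i => (⟪ρ.sqrtOp (stdBasis H i), M.effect B (ρ.sqrtOp (stdBasis H i))⟫_ℂ).re)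
      (trace (ρ.op ∘L M.effect B)).re :=
  Complex.reCLM.hasSum (ρ.hasSum_sqrtOp (M.effect B))

/-- The probability distribution `B ↦ tr[ρ M(B)]` of the outcomes of the measurement `M` in the
state `ρ`; the traces are real and non-negative, see `law_apply`. -/
noncomputable def law : Measure Ω :=
  Measure.ofMeasurable (fun B _ => ENNReal.ofReal (trace (ρ.op ∘L M.effect B)).re)
    (by rw [← (M.hasSum_re_sqrtOp ρ).tsum_eq]; simp [inner_effect_empty])
    (by
      intro B hB hd
      have key (C : Set Ω) (hC : MeasurableSet C) :
          ENNReal.ofReal (trace (ρ.op ∘L M.effect C)).re =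
            ∑' i, ENNReal.ofReal
              (⟪ρ.sqrtOp (stdBasis H i), M.effect C (ρ.sqrtOp (stdBasis H i))⟫_ℂ).re := by
        rw [← (M.hasSum_re_sqrtOp ρ).tsum_eq]
        exact ENNReal.ofReal_tsum_of_nonneg (fun i => M.re_inner_effect_nonneg hC _)
          (M.hasSum_re_sqrtOp ρ).summable
      rw [key _ (MeasurableSet.iUnion hB)]
      simp_rw [fun n => key (B n) (hB n)]
      rw [ENNReal.tsum_comm]
      congr 1
      ext i
      have h := Complex.reCLM.hasSum (M.hasSum_effect B hB hd (ρ.sqrtOp (stdBasis H i))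
        (ρ.sqrtOp (stdBasis H i)))
      have h' := ENNReal.ofReal_tsum_of_nonneg
        (fun n => M.re_inner_effect_nonneg (hB n) (ρ.sqrtOp (stdBasis H i))) h.summable
      rw [← h']
      exact congrArg ENNReal.ofReal h.tsum_eq.symm)

theorem law_apply {B : Set Ω} (hB : MeasurableSet B) :
    ((law ρ M).real B : ℂ) = trace (ρ.op ∘L M.effect B) := by
  have h0 : 0 ≤ (trace (ρ.op ∘L M.effect B)).re :=
    (M.hasSum_re_sqrtOp ρ).nonneg fun i => M.re_inner_effect_nonneg hB _
  have him : (trace (ρ.op ∘L M.effect B)).im = 0 := by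
    have h := Complex.imCLM.hasSum (ρ.hasSum_sqrtOp (M.effect B))
    have hz (i) : Complex.imCLM
        ⟪ρ.sqrtOp (stdBasis H i), M.effect B (ρ.sqrtOp (stdBasis H i))⟫_ℂ = 0 := by
      simpa using (M.isPositive B hB).isSymmetric.im_inner_self_apply (ρ.sqrtOp (stdBasis H i))
    simp only [hz] at h
    exact h.unique hasSum_zero
  rw [Measure.real, law, Measure.ofMeasurable_apply _ hB, ENNReal.toReal_ofReal h0]
  exact Complex.ext (by simp) (by simp [him])

end Law

section Joint

variable {H₁ H₂ : Type*} [NormedAddCommGroup H₁] [InnerProductSpace ℂ H₁]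
  [NormedAddCommGroup H₂] [InnerProductSpace ℂ H₂]

/-- The POVM `M` on `Ω₁ × Ω₂` describes the joint measurement in which Alice measures `M₁` and Bob
measures `M₂`: `M(B₁ × B₂) = M₁(B₁) ⊗ M₂(B₂)`. -/
def IsJointMeasurement {Ω₁ Ω₂ : Type*} [MeasurableSpace Ω₁] [MeasurableSpace Ω₂]
    (M : POVM (Ω₁ × Ω₂) (HilbertTensor H₁ H₂)) (M₁ : POVM Ω₁ H₁) (M₂ : POVM Ω₂ H₂) : Prop :=
  ∀ (B₁ : Set Ω₁) (B₂ : Set Ω₂), MeasurableSet B₁ → MeasurableSet B₂ →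
    M.effect (B₁ ×ˢ B₂) = opTensor (M₁.effect B₁) (M₂.effect B₂)


section Existence

variable {Ω : Type*} [MeasurableSpace Ω] {H : Type*} [NormedAddCommGroup H]
  [InnerProductSpace ℂ H]

/-- The measure `B ↦ ⟪x, M(B) x⟫`. -/
noncomputable def scalarMeasure (M : POVM Ω H) (x : H) : Measure Ω :=
  Measure.ofMeasurable (fun B _ => ENNReal.ofReal (⟪x, M.effect B x⟫_ℂ).re)
    (by simp [inner_effect_empty])
    (by
      intro B hB hd
      have h := Complex.reCLM.hasSum (M.hasSum_effect B hB hd x x)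
      rw [← ENNReal.ofReal_tsum_of_nonneg (fun n => M.re_inner_effect_nonneg (hB n) x) h.summable]
      exact congrArg ENNReal.ofReal h.tsum_eq.symm)

theorem scalarMeasure_apply (M : POVM Ω H) (x : H) {B : Set Ω} (hB : MeasurableSet B) :
    M.scalarMeasure x B = ENNReal.ofReal (⟪x, M.effect B x⟫_ℂ).re :=
  Measure.ofMeasurable_apply _ hB

instance (M : POVM Ω H) (x : H) : IsFiniteMeasure (M.scalarMeasure x) :=
  ⟨by rw [scalarMeasure_apply _ _ MeasurableSet.univ]; exact ENNReal.ofReal_lt_top⟩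

open scoped Classical in
/-- The complex measure `B ↦ ⟪x, M(B) y⟫`. -/
noncomputable def innerMeasure (M : POVM Ω H) (x y : H) : VectorMeasure Ω ℂ where
  measureOf' B := if MeasurableSet B then ⟪x, M.effect B y⟫_ℂ else 0
  empty' := by simp [inner_effect_empty]
  not_measurable' _ h := by simp [h]
  m_iUnion' B hB hd := by
    simpa only [hB, MeasurableSet.iUnion hB, if_true] using M.hasSum_effect B hB hd x y

theorem innerMeasure_apply (M : POVM Ω H) (x y : H) {B : Set Ω} (hB : MeasurableSet B) :
    M.innerMeasure x y B = ⟪x, M.effect B y⟫_ℂ := if_pos hB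

theorem norm_inner_effect_le (M : POVM Ω H) (x y : H) {B : Set Ω} (hB : MeasurableSet B) :
    ‖⟪x, M.effect B y⟫_ℂ‖ ≤ (⟪x, M.effect B x⟫_ℂ).re + (⟪y, M.effect B y⟫_ℂ).re := by
  obtain ⟨c, hc, hcx⟩ : ∃ c : ℂ, ‖c‖ = 1 ∧ c * ⟪x, M.effect B y⟫_ℂ = ‖⟪x, M.effect B y⟫_ℂ‖ := by
    by_cases h : ⟪x, M.effect B y⟫_ℂ = 0
    · exact ⟨1, by simp, by simp [h]⟩
    · refine ⟨‖⟪x, M.effect B y⟫_ℂ‖ / ⟪x, M.effect B y⟫_ℂ, by simp [h], by field_simp⟩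
  have h1 := M.re_inner_effect_nonneg hB (x - c • y)
  have hs : ⟪y, M.effect B x⟫_ℂ = starRingEnd ℂ ⟪x, M.effect B y⟫_ℂ := by
    rw [inner_conj_symm]
    exact ((M.isPositive B hB).isSymmetric y x).symm
  have hcc : starRingEnd ℂ c * c = 1 := by
    rw [mul_comm, Complex.mul_conj']; simp [hc]
  have e : ⟪x - c • y, M.effect B (x - c • y)⟫_ℂ = ⟪x, M.effect B x⟫_ℂ + ⟪y, M.effect B y⟫_ℂ
      - ‖⟪x, M.effect B y⟫_ℂ‖ - ‖⟪x, M.effect B y⟫_ℂ‖ := by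
    have h2 : starRingEnd ℂ c * starRingEnd ℂ ⟪x, M.effect B y⟫_ℂ = ‖⟪x, M.effect B y⟫_ℂ‖ := by
      rw [← map_mul, hcx, Complex.conj_ofReal]
    simp only [map_sub, map_smul, inner_sub_left, inner_sub_right, inner_smul_left,
      inner_smul_right, hs]
    linear_combination (⟪y, M.effect B y⟫_ℂ) * hcc - hcx - h2
  rw [e] at h1
  simp only [Complex.sub_re, Complex.add_re, Complex.ofReal_re] at h1
  have := norm_nonneg ⟪x, M.effect B y⟫_ℂ
  linarith [M.re_inner_effect_nonneg hB x, M.re_inner_effect_nonneg hB y]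

instance (M : POVM Ω H) (x y : H) : IsFiniteMeasure (M.innerMeasure x y).variation := by
  refine isFiniteMeasure_of_le (M.scalarMeasure x + M.scalarMeasure y) ?_
  refine VectorMeasure.variation_le_of_forall_enorm_le fun B hB => ?_
  rw [innerMeasure_apply _ _ _ hB, Measure.add_apply, scalarMeasure_apply _ _ hB,
    scalarMeasure_apply _ _ hB, ← ENNReal.ofReal_add (M.re_inner_effect_nonneg hB x)
    (M.re_inner_effect_nonneg hB y), ← ofReal_norm]
  exact ENNReal.ofReal_le_ofReal (M.norm_inner_effect_le x y hB)

theorem isSetSemiring_rectangles (Ω₁ Ω₂ : Type*) [MeasurableSpace Ω₁] [MeasurableSpace Ω₂] :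
    IsSetSemiring (Set.image2 (fun (s : Set Ω₁) (t : Set Ω₂) => s ×ˢ t)
      {s | MeasurableSet s} {t | MeasurableSet t}) where
  empty_mem := ⟨∅, MeasurableSet.empty, ∅, MeasurableSet.empty, by simp⟩
  inter_mem := by
    rintro _ ⟨s, hs, t, ht, rfl⟩ _ ⟨s', hs', t', ht', rfl⟩
    exact ⟨s ∩ s', hs.inter hs', t ∩ t', ht.inter ht', Set.prod_inter_prod.symm⟩
  sdiff_eq_sUnion' := by
    classical
    rintro _ ⟨s, hs, t, ht, rfl⟩ _ ⟨s', hs', t', ht', rfl⟩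
    refine ⟨{(s \ s') ×ˢ t, (s ∩ s') ×ˢ (t \ t')}, ?_, ?_, ?_⟩
    · intro u hu
      simp only [Finset.coe_insert, Finset.coe_singleton, Set.mem_insert_iff,
        Set.mem_singleton_iff] at hu
      rcases hu with rfl | rfl
      · exact ⟨_, hs.diff hs', _, ht, rfl⟩
      · exact ⟨_, hs.inter hs', _, ht.diff ht', rfl⟩
    · have hd : Disjoint ((s \ s') ×ˢ t) ((s ∩ s') ×ˢ (t \ t')) :=
        Set.Disjoint.set_prod_left (Set.disjoint_left.2 fun a ha hb => ha.2 hb.2) _ _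
      intro u hu v hv huv
      simp only [Finset.coe_insert, Finset.coe_singleton, Set.mem_insert_iff,
        Set.mem_singleton_iff] at hu hv
      rcases hu with rfl | rfl <;> rcases hv with rfl | rfl
      · exact absurd rfl huv
      · exact hd
      · exact hd.symm
      · exact absurd rfl huv
    · ext ⟨a, b⟩
      simp only [Set.mem_sdiff, Set.mem_prod, Finset.coe_insert, Finset.coe_singleton,
        Set.sUnion_insert, Set.sUnion_singleton, Set.mem_union, Set.mem_inter_iff]
      tauto

/-- A complex measure of finite variation on a product that has non-negative real part on
measurable rectangles has non-negative real part. -/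
theorem re_nonneg_of_rectangles {Ω₁ Ω₂ : Type*} [MeasurableSpace Ω₁] [MeasurableSpace Ω₂]
    (ν : VectorMeasure (Ω₁ × Ω₂) ℂ) [IsFiniteMeasure ν.variation]
    (h : ∀ (s : Set Ω₁) (t : Set Ω₂), MeasurableSet s → MeasurableSet t → 0 ≤ (ν (s ×ˢ t)).re)
    {B : Set (Ω₁ × Ω₂)} (hB : MeasurableSet B) : 0 ≤ (ν B).re := by
  have hC := isSetSemiring_rectangles Ω₁ Ω₂
  refine le_of_forall_pos_lt_add fun ε hε => ?_
  obtain ⟨s, hs, hlt⟩ := exists_measure_symmDiff_lt_of_generateFrom_isSetSemiring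
    (μ := ν.variation) hC ⟨{Set.univ}, Set.countable_singleton _, by
      rintro _ rfl
      exact ⟨Set.univ, MeasurableSet.univ, Set.univ, MeasurableSet.univ, by simp⟩, by simp⟩
    generateFrom_prod.symm hB (ENNReal.ofReal_pos.2 hε)
  obtain ⟨P, hP⟩ := hC.mem_supClosure_iff.1 hs
  have hPm : ∀ b ∈ P.parts, MeasurableSet b := by
    intro b hb
    obtain ⟨s, hs, t, ht, rfl⟩ := hP hb
    exact hs.prod ht
  have hsU : s = ⋃ b ∈ P.parts, id b := by
    conv_lhs => rw [← P.sup_parts, Finset.sup_set_eq_biUnion]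
  have hsm : MeasurableSet s := by
    rw [hsU]; exact Finset.measurableSet_biUnion _ hPm
  have hpos : 0 ≤ (ν s).re := by
    rw [hsU, VectorMeasure.of_biUnion_finset (f := id) P.disjoint hPm, Complex.re_sum]
    refine Finset.sum_nonneg fun b hb => ?_
    obtain ⟨s, hs, t, ht, rfl⟩ := hP hb
    exact h s t hs ht
  have e1 : ν B = ν (B \ s) + ν (B ∩ s) := by
    rw [← VectorMeasure.of_union (Set.disjoint_left.2 fun a ha hb => ha.2 hb.2) (hB.diff hsm)
      (hB.inter hsm), Set.sdiff_union_inter]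
  have e2 : ν s = ν (s \ B) + ν (B ∩ s) := by
    rw [← VectorMeasure.of_union (Set.disjoint_left.2 fun a ha hb => ha.2 hb.1) (hsm.diff hB)
      (hB.inter hsm), Set.inter_comm, Set.sdiff_union_inter]
  have hb (A : Set (Ω₁ × Ω₂)) : ‖ν A‖ ≤ ν.variation.real A :=
    VectorMeasure.norm_measure_le_variation (measure_ne_top _ _)
  have hlt' : ν.variation.real (s \ B) + ν.variation.real (B \ s) < ε := by
    rw [← measureReal_union (Set.disjoint_left.2 fun a ha hb => ha.2 hb.1) (hB.diff hsm)]
    exact (ENNReal.toReal_lt_of_lt_ofReal hlt)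
  have h1 := (Complex.abs_re_le_norm _).trans (hb (s \ B))
  have h2 := (Complex.abs_re_le_norm _).trans (hb (B \ s))
  have h3 := congrArg Complex.re e1
  have h4 := congrArg Complex.re e2
  simp only [Complex.add_re] at h3 h4
  have := abs_le.1 h1
  have := abs_le.1 h2
  linarith

variable {Ω₁ Ω₂ : Type*} [MeasurableSpace Ω₁] [MeasurableSpace Ω₂]
  (M₁ : POVM Ω₁ H₁) (M₂ : POVM Ω₂ H₂)

theorem exists_tensorMeasure (t t' : H₁ ⊗[ℂ] H₂) :
    ∃ ν : VectorMeasure (Ω₁ × Ω₂) ℂ, IsFiniteMeasure ν.variation ∧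
      ∀ (B₁ : Set Ω₁) (B₂ : Set Ω₂), MeasurableSet B₁ → MeasurableSet B₂ →
        ν (B₁ ×ˢ B₂) = ⟪t, TensorProduct.mapL (M₁.effect B₁) (M₂.effect B₂) t'⟫_ℂ := by
  have add {a b c : (B₁ : Set Ω₁) → (B₂ : Set Ω₂) → ℂ} (hc : ∀ B₁ B₂, c B₁ B₂ = a B₁ B₂ + b B₁ B₂) :
      (∃ ν : VectorMeasure (Ω₁ × Ω₂) ℂ, IsFiniteMeasure ν.variation ∧
        ∀ (B₁ : Set Ω₁) (B₂ : Set Ω₂), MeasurableSet B₁ → MeasurableSet B₂ →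
          ν (B₁ ×ˢ B₂) = a B₁ B₂) →
      (∃ ν : VectorMeasure (Ω₁ × Ω₂) ℂ, IsFiniteMeasure ν.variation ∧
        ∀ (B₁ : Set Ω₁) (B₂ : Set Ω₂), MeasurableSet B₁ → MeasurableSet B₂ →
          ν (B₁ ×ˢ B₂) = b B₁ B₂) →
      ∃ ν : VectorMeasure (Ω₁ × Ω₂) ℂ, IsFiniteMeasure ν.variation ∧
        ∀ (B₁ : Set Ω₁) (B₂ : Set Ω₂), MeasurableSet B₁ → MeasurableSet B₂ →
          ν (B₁ ×ˢ B₂) = c B₁ B₂ := by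
    rintro ⟨ν, h, hν⟩ ⟨ν', h', hν'⟩
    exact ⟨ν + ν', isFiniteMeasure_of_le _ VectorMeasure.variation_add_le,
      fun B₁ B₂ h₁ h₂ => by simp [hc, hν B₁ B₂ h₁ h₂, hν' B₁ B₂ h₁ h₂]⟩
  have zero : IsFiniteMeasure (0 : VectorMeasure (Ω₁ × Ω₂) ℂ).variation := by
    rw [VectorMeasure.variation_zero]; infer_instance
  induction t using TensorProduct.induction_on with
  | zero => exact ⟨0, zero, by simp⟩
  | add a b ha hb => exact add (fun B₁ B₂ => inner_add_left _ _ _) ha hb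
  | tmul x y =>
    induction t' using TensorProduct.induction_on with
    | zero => exact ⟨0, zero, by simp⟩
    | add a b ha hb =>
      exact add (fun B₁ B₂ => by rw [map_add, inner_add_right]) ha hb
    | tmul x' y' =>
      refine ⟨(M₁.innerMeasure x x').prod (M₂.innerMeasure y y') (ContinuousLinearMap.mul ℝ ℂ),
        inferInstance, fun B₁ B₂ h₁ h₂ => ?_⟩
      simp [innerMeasure_apply, h₁, h₂]

/-- The complex measure on `Ω₁ × Ω₂` with `B₁ × B₂ ↦ ⟪t, (M₁(B₁) ⊗ M₂(B₂)) t'⟫`. -/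
noncomputable def tensorMeasure (t t' : H₁ ⊗[ℂ] H₂) : VectorMeasure (Ω₁ × Ω₂) ℂ :=
  (exists_tensorMeasure M₁ M₂ t t').choose

instance (t t' : H₁ ⊗[ℂ] H₂) : IsFiniteMeasure (tensorMeasure M₁ M₂ t t').variation :=
  (exists_tensorMeasure M₁ M₂ t t').choose_spec.1

theorem tensorMeasure_prod (t t' : H₁ ⊗[ℂ] H₂) {B₁ : Set Ω₁} {B₂ : Set Ω₂}
    (h₁ : MeasurableSet B₁) (h₂ : MeasurableSet B₂) :
    tensorMeasure M₁ M₂ t t' (B₁ ×ˢ B₂) =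
      ⟪t, TensorProduct.mapL (M₁.effect B₁) (M₂.effect B₂) t'⟫_ℂ :=
  (exists_tensorMeasure M₁ M₂ t t').choose_spec.2 B₁ B₂ h₁ h₂

theorem tensorMeasure_univ (t t' : H₁ ⊗[ℂ] H₂) :
    tensorMeasure M₁ M₂ t t' Set.univ = ⟪t, t'⟫_ℂ := by
  rw [← Set.univ_prod_univ, tensorMeasure_prod _ _ _ _ MeasurableSet.univ MeasurableSet.univ,
    M₁.effect_univ, M₂.effect_univ]
  congr 1
  exact congrArg (fun A : (H₁ ⊗[ℂ] H₂) →L[ℂ] (H₁ ⊗[ℂ] H₂) => A t')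
    (TensorProduct.mapL_id_id (𝕜 := ℂ) (E := H₁) (G := H₂))

theorem ext_rectangles {ν ν' : VectorMeasure (Ω₁ × Ω₂) ℂ}
    (h : ∀ (B₁ : Set Ω₁) (B₂ : Set Ω₂), MeasurableSet B₁ → MeasurableSet B₂ →
      ν (B₁ ×ˢ B₂) = ν' (B₁ ×ˢ B₂)) : ν = ν' := by
  refine VectorMeasure.ext_of_generateFrom _ ?_ generateFrom_prod.symm isPiSystem_prod ?_
  · rintro _ ⟨s, hs, t, ht, rfl⟩
    exact h s t hs ht
  · rw [← Set.univ_prod_univ]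
    exact h _ _ MeasurableSet.univ MeasurableSet.univ

theorem tensorMeasure_add_right (t a b : H₁ ⊗[ℂ] H₂) :
    tensorMeasure M₁ M₂ t (a + b) = tensorMeasure M₁ M₂ t a + tensorMeasure M₁ M₂ t b :=
  ext_rectangles fun B₁ B₂ h₁ h₂ => by
    rw [_root_.add_apply]
    simp only [tensorMeasure_prod M₁ M₂ _ _ h₁ h₂, map_add, inner_add_right]

theorem tensorMeasure_smul_right (t a : H₁ ⊗[ℂ] H₂) (c : ℂ) :
    tensorMeasure M₁ M₂ t (c • a) = c • tensorMeasure M₁ M₂ t a :=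
  ext_rectangles fun B₁ B₂ h₁ h₂ => by
    rw [_root_.smul_apply]
    simp only [tensorMeasure_prod M₁ M₂ _ _ h₁ h₂, map_smul, smul_eq_mul]
    exact inner_smul_right (𝕜 := ℂ) t _ c

theorem inner_mapL_symm {A : H₁ →L[ℂ] H₁} {B : H₂ →L[ℂ] H₂} (hA : A.IsPositive)
    (hB : B.IsPositive) (t t' : H₁ ⊗[ℂ] H₂) :
    ⟪TensorProduct.mapL A B t, t'⟫_ℂ = ⟪t, TensorProduct.mapL A B t'⟫_ℂ := by
  induction t using TensorProduct.induction_on with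
  | zero => simp
  | add a b ha hb => rw [map_add, inner_add_left, inner_add_left, ha, hb]
  | tmul x y =>
    induction t' using TensorProduct.induction_on with
    | zero => simp
    | add a b ha hb => rw [map_add, inner_add_right, inner_add_right, ha, hb]
    | tmul x' y' =>
      have h₁ : ⟪A x, x'⟫_ℂ = ⟪x, A x'⟫_ℂ := hA.isSymmetric x x'
      have h₂ : ⟪B y, y'⟫_ℂ = ⟪y, B y'⟫_ℂ := hB.isSymmetric y y'
      simp [h₁, h₂]

theorem tensorMeasure_conj (t t' : H₁ ⊗[ℂ] H₂) (B : Set (Ω₁ × Ω₂)) :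
    starRingEnd ℂ (tensorMeasure M₁ M₂ t t' B) = tensorMeasure M₁ M₂ t' t B := by
  have : (tensorMeasure M₁ M₂ t t').mapRange (starRingEnd ℂ).toAddMonoidHom
      Complex.continuous_conj = tensorMeasure M₁ M₂ t' t :=
    ext_rectangles fun B₁ B₂ h₁ h₂ => by
      rw [VectorMeasure.mapRange_apply]
      simp only [tensorMeasure_prod M₁ M₂ _ _ h₁ h₂]
      rw [← inner_mapL_symm (M₁.isPositive _ h₁) (M₂.isPositive _ h₂)]
      exact inner_conj_symm _ _
  rw [← this]
  rfl

theorem op_ext_tensor {P Q : HilbertTensor H₁ H₂ →L[ℂ] HilbertTensor H₁ H₂}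
    (h : ∀ t t' : H₁ ⊗[ℂ] H₂, ⟪(t : HilbertTensor H₁ H₂), P t'⟫_ℂ =
      ⟪(t : HilbertTensor H₁ H₂), Q t'⟫_ℂ) : P = Q := by
  ext z
  refine ext_inner_left ℂ fun w => ?_
  induction w, z using UniformSpace.Completion.induction_on₂ with
  | hp => exact isClosed_eq (by fun_prop) (by fun_prop)
  | ih t t' => exact h t t'

variable [CompleteSpace H₁] [CompleteSpace H₂]

theorem re_inner_mapL_nonneg {A : H₁ →L[ℂ] H₁} {B : H₂ →L[ℂ] H₂} (hA : A.IsPositive)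
    (hB : B.IsPositive) (t : H₁ ⊗[ℂ] H₂) : 0 ≤ (⟪t, TensorProduct.mapL A B t⟫_ℂ).re := by
  have hA' := (ContinuousLinearMap.nonneg_iff_isPositive A).2 hA
  have hB' := (ContinuousLinearMap.nonneg_iff_isPositive B).2 hB
  rw [← CFC.sqrt_mul_sqrt_self A hA', ← CFC.sqrt_mul_sqrt_self B hB', TensorProduct.mapL_mul,
    mul_apply_eq_comp, ← inner_mapL_symm
      ((ContinuousLinearMap.nonneg_iff_isPositive _).1 (CFC.sqrt_nonneg A))
      ((ContinuousLinearMap.nonneg_iff_isPositive _).1 (CFC.sqrt_nonneg B))]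
  exact inner_self_nonneg (𝕜 := ℂ)

theorem re_tensorMeasure_nonneg (t : H₁ ⊗[ℂ] H₂) {B : Set (Ω₁ × Ω₂)} (hB : MeasurableSet B) :
    0 ≤ (tensorMeasure M₁ M₂ t t B).re := by
  refine re_nonneg_of_rectangles _ (fun B₁ B₂ h₁ h₂ => ?_) hB
  rw [tensorMeasure_prod M₁ M₂ _ _ h₁ h₂]
  exact re_inner_mapL_nonneg (M₁.isPositive _ h₁) (M₂.isPositive _ h₂) t

theorem re_tensorMeasure_le (t : H₁ ⊗[ℂ] H₂) {B : Set (Ω₁ × Ω₂)} (hB : MeasurableSet B) :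
    (tensorMeasure M₁ M₂ t t B).re ≤ ‖t‖ ^ 2 := by
  have h := re_tensorMeasure_nonneg M₁ M₂ t hB.compl
  have e := congrArg Complex.re (VectorMeasure.of_add_of_sdiff (v := tensorMeasure M₁ M₂ t t)
    hB MeasurableSet.univ (Set.subset_univ B))
  rw [tensorMeasure_univ, Complex.add_re, ← Set.compl_eq_univ_sdiff] at e
  have : (⟪t, t⟫_ℂ).re = ‖t‖ ^ 2 := inner_self_eq_norm_sq (𝕜 := ℂ) t
  linarith

theorem norm_tensorMeasure_le (t t' : H₁ ⊗[ℂ] H₂) {B : Set (Ω₁ × Ω₂)} (hB : MeasurableSet B) :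
    ‖tensorMeasure M₁ M₂ t t' B‖ ≤ ‖t‖ * ‖t'‖ := by
  let c : PreInnerProductSpace.Core ℂ (H₁ ⊗[ℂ] H₂) :=
    { inner := fun t t' => tensorMeasure M₁ M₂ t t' B
      conj_inner_symm := fun x y => tensorMeasure_conj M₁ M₂ y x B
      re_inner_nonneg := fun x => re_tensorMeasure_nonneg M₁ M₂ x hB
      add_left := fun x y z => by
        rw [← tensorMeasure_conj, tensorMeasure_add_right, _root_.add_apply, map_add,
          tensorMeasure_conj, tensorMeasure_conj]
      smul_left := fun x y r => by
        rw [← tensorMeasure_conj, tensorMeasure_smul_right, _root_.smul_apply, smul_eq_mul,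
          map_mul, tensorMeasure_conj] }
  have h := @InnerProductSpace.Core.inner_mul_inner_self_le ℂ (H₁ ⊗[ℂ] H₂) _ _ _ c t t'
  have h' : ‖tensorMeasure M₁ M₂ t t' B‖ * ‖tensorMeasure M₁ M₂ t' t B‖ ≤
    (tensorMeasure M₁ M₂ t t B).re * (tensorMeasure M₁ M₂ t' t' B).re := h
  rw [← tensorMeasure_conj M₁ M₂ t t', RCLike.norm_conj] at h'
  have h1 := re_tensorMeasure_le M₁ M₂ t hB
  have h2 := re_tensorMeasure_le M₁ M₂ t' hB
  have h3 := re_tensorMeasure_nonneg M₁ M₂ t' hB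
  refine abs_le_of_sq_le_sq' ?_ (by positivity) |>.2
  calc _ = _ := sq _
    _ ≤ _ := h'
    _ ≤ ‖t‖ ^ 2 * ‖t'‖ ^ 2 := by gcongr
    _ = _ := by ring

theorem exists_jointEffect {B : Set (Ω₁ × Ω₂)} (hB : MeasurableSet B) :
    ∃ P : HilbertTensor H₁ H₂ →L[ℂ] HilbertTensor H₁ H₂, ∀ t t' : H₁ ⊗[ℂ] H₂,
      ⟪(t : HilbertTensor H₁ H₂), P t'⟫_ℂ = tensorMeasure M₁ M₂ t t' B := by
  let f (t' : H₁ ⊗[ℂ] H₂) : (H₁ ⊗[ℂ] H₂) →L[ℂ] ℂ := LinearMap.mkContinuous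
    { toFun := fun t => tensorMeasure M₁ M₂ t' t B
      map_add' := fun a b => by rw [tensorMeasure_add_right, _root_.add_apply]
      map_smul' := fun c a => by
        rw [tensorMeasure_smul_right, _root_.smul_apply, RingHom.id_apply] } ‖t'‖
    (fun t => norm_tensorMeasure_le M₁ M₂ t' t hB)
  let v (t' : H₁ ⊗[ℂ] H₂) : HilbertTensor H₁ H₂ :=
    (InnerProductSpace.toDual ℂ (HilbertTensor H₁ H₂)).symm (f t').fromCompletion
  have hv (t t' : H₁ ⊗[ℂ] H₂) :
      ⟪(t : HilbertTensor H₁ H₂), v t'⟫_ℂ = tensorMeasure M₁ M₂ t t' B := by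
    rw [← inner_conj_symm, InnerProductSpace.toDual_symm_apply,
      ContinuousLinearMap.fromCompletion_apply_coe]
    exact tensorMeasure_conj M₁ M₂ t' t B
  have hext {x y : HilbertTensor H₁ H₂}
      (h : ∀ t : H₁ ⊗[ℂ] H₂, ⟪(t : HilbertTensor H₁ H₂), x⟫_ℂ = ⟪(t : HilbertTensor H₁ H₂), y⟫_ℂ) :
      x = y := by
    refine ext_inner_left ℂ fun z => ?_
    induction z using UniformSpace.Completion.induction_on with
    | hp => exact isClosed_eq (by fun_prop) (by fun_prop)
    | ih t => exact h t
  have hnorm (t' : H₁ ⊗[ℂ] H₂) : ‖v t'‖ ≤ 1 * ‖t'‖ := by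
    rw [one_mul, LinearIsometryEquiv.norm_map]
    refine ContinuousLinearMap.opNorm_le_bound _ (norm_nonneg _) fun z => ?_
    induction z using UniformSpace.Completion.induction_on with
    | hp => exact isClosed_le (by fun_prop) (by fun_prop)
    | ih t =>
      rw [ContinuousLinearMap.fromCompletion_apply_coe, UniformSpace.Completion.norm_coe]
      exact norm_tensorMeasure_le M₁ M₂ t' t hB
  refine ⟨(LinearMap.mkContinuous
    { toFun := v
      map_add' := fun a b => hext fun t => by
        rw [inner_add_right, hv, hv, hv, tensorMeasure_add_right, _root_.add_apply]
      map_smul' := fun c a => hext fun t => by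
        rw [RingHom.id_apply, inner_smul_right, hv, hv, tensorMeasure_smul_right,
          _root_.smul_apply, smul_eq_mul] } 1 hnorm).fromCompletion, fun t t' => ?_⟩
  rw [ContinuousLinearMap.fromCompletion_apply_coe]
  exact hv t t'

/-- The POVM on `Ω₁ × Ω₂` with `M(B₁ × B₂) = M₁(B₁) ⊗ M₂(B₂)` exists. -/
theorem exists_joint :
    ∃ M : POVM (Ω₁ × Ω₂) (HilbertTensor H₁ H₂), M.IsJointMeasurement M₁ M₂ := by
  classical
  choose! P hP using fun B (hB : MeasurableSet B) => exists_jointEffect M₁ M₂ hB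
  have hpos (B : Set (Ω₁ × Ω₂)) (hB : MeasurableSet B) : (P B).IsPositive := by
    refine ⟨fun z w => ?_, fun z => ?_⟩
    · change ⟪P B z, w⟫_ℂ = ⟪z, P B w⟫_ℂ
      induction z, w using UniformSpace.Completion.induction_on₂ with
      | hp => exact isClosed_eq (by fun_prop) (by fun_prop)
      | ih t t' => rw [← inner_conj_symm, hP B hB, hP B hB, tensorMeasure_conj]
    · rw [ContinuousLinearMap.reApplyInnerSelf_apply]
      induction z using UniformSpace.Completion.induction_on with
      | hp => exact isClosed_le (by fun_prop) (by fun_prop)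
      | ih t =>
        rw [inner_re_symm, hP B hB]
        exact re_tensorMeasure_nonneg M₁ M₂ t hB
  have huniv : P Set.univ = 1 := op_ext_tensor fun t t' => by
    rw [hP _ MeasurableSet.univ, tensorMeasure_univ]
    exact (UniformSpace.Completion.inner_coe t t').symm
  have hle (B : Set (Ω₁ × Ω₂)) (hB : MeasurableSet B) (z w : HilbertTensor H₁ H₂) :
      ‖⟪z, P B w⟫_ℂ‖ ≤ ‖z‖ * ‖w‖ := by
    induction z, w using UniformSpace.Completion.induction_on₂ with
    | hp => exact isClosed_le (by fun_prop) (by fun_prop)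
    | ih t t' =>
      rw [hP B hB, UniformSpace.Completion.norm_coe, UniformSpace.Completion.norm_coe]
      exact norm_tensorMeasure_le M₁ M₂ t t' hB
  refine ⟨⟨P, hpos, huniv, fun B hB hd z w => ?_⟩, fun B₁ B₂ h₁ h₂ => ?_⟩
  · have hsum (F : Finset ℕ) : ∑ n ∈ F, P (B n) = P (⋃ n ∈ F, B n) := op_ext_tensor fun t t' => by
      rw [hP _ (Finset.measurableSet_biUnion _ fun n _ => hB n),
        VectorMeasure.of_biUnion_finset (hd.set_pairwise _) fun n _ => hB n,
        _root_.sum_apply, inner_sum]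
      exact Finset.sum_congr rfl fun n _ => hP _ (hB n) t t'
    have hbd (F : Finset ℕ) (z w : HilbertTensor H₁ H₂) :
        ‖∑ n ∈ F, ⟪z, P (B n) w⟫_ℂ‖ ≤ ‖z‖ * ‖w‖ := by
      rw [← inner_sum, ← _root_.sum_apply, hsum]
      exact hle _ (Finset.measurableSet_biUnion _ fun n _ => hB n) z w
    have hbU := hle _ (MeasurableSet.iUnion hB)
    rw [HasSum, SummationFilter.unconditional_filter, Metric.tendsto_nhds]
    intro ε hε
    have hdense := UniformSpace.Completion.denseRange_coe (α := H₁ ⊗[ℂ] H₂)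
    set δ : ℝ := ε / (8 * (‖z‖ + ‖w‖ + 1)) with hδ
    have hδ0 : 0 < δ := by positivity
    obtain ⟨t', ht'⟩ := hdense.exists_dist_lt w hδ0
    obtain ⟨t, ht⟩ := hdense.exists_dist_lt z
      (show 0 < ε / (8 * (‖(t' : HilbertTensor H₁ H₂)‖ + 1)) by positivity)
    rw [dist_eq_norm] at ht ht'
    have hconv : HasSum (fun n => ⟪(t : HilbertTensor H₁ H₂), P (B n) t'⟫_ℂ)
        ⟪(t : HilbertTensor H₁ H₂), P (⋃ n, B n) t'⟫_ℂ := by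
      simp_rw [hP _ (MeasurableSet.iUnion hB), fun n => hP _ (hB n)]
      exact VectorMeasure.hasSum_of_disjoint_iUnion hB hd
    rw [HasSum, SummationFilter.unconditional_filter, Metric.tendsto_nhds] at hconv
    have e1 : ‖z‖ * ‖w - t'‖ ≤ ε / 8 := by
      calc ‖z‖ * ‖w - t'‖ ≤ (‖z‖ + ‖w‖ + 1) * δ := by
            gcongr
            linarith [norm_nonneg w]
        _ = ε / 8 := by rw [hδ]; field_simp
    have e2 : ‖z - t‖ * ‖(t' : HilbertTensor H₁ H₂)‖ ≤ ε / 8 := by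
      calc ‖z - t‖ * ‖(t' : HilbertTensor H₁ H₂)‖
          ≤ ε / (8 * (‖(t' : HilbertTensor H₁ H₂)‖ + 1)) * (‖(t' : HilbertTensor H₁ H₂)‖ + 1) := by
            gcongr
            linarith
        _ = ε / 8 := by field_simp
    have dec (A : HilbertTensor H₁ H₂ →L[ℂ] HilbertTensor H₁ H₂) : ⟪z, A w⟫_ℂ =
        ⟪z, A (w - t')⟫_ℂ + ⟪z - t, A t'⟫_ℂ + ⟪(t : HilbertTensor H₁ H₂), A t'⟫_ℂ := by
      rw [map_sub, inner_sub_right, inner_sub_left]; ring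
    filter_upwards [hconv (ε / 4) (by positivity)] with F hF
    rw [dist_eq_norm] at hF ⊢
    have e3 : ∑ n ∈ F, ⟪z, P (B n) w⟫_ℂ - ⟪z, P (⋃ n, B n) w⟫_ℂ =
        (∑ n ∈ F, ⟪z, P (B n) (w - t')⟫_ℂ - ⟪z, P (⋃ n, B n) (w - t')⟫_ℂ) +
        (∑ n ∈ F, ⟪z - t, P (B n) t'⟫_ℂ - ⟪z - t, P (⋃ n, B n) t'⟫_ℂ) +
        (∑ n ∈ F, ⟪(t : HilbertTensor H₁ H₂), P (B n) t'⟫_ℂ -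
          ⟪(t : HilbertTensor H₁ H₂), P (⋃ n, B n) t'⟫_ℂ) := by
      rw [dec (P (⋃ n, B n)), Finset.sum_congr rfl fun n _ => dec (P (B n)),
        Finset.sum_add_distrib, Finset.sum_add_distrib]
      ring
    rw [e3]
    have b1 := (norm_sub_le _ _).trans (add_le_add (hbd F z (w - t')) (hbU z (w - t')))
    have b2 := (norm_sub_le _ _).trans (add_le_add (hbd F (z - t) t') (hbU (z - t) t'))
    refine (norm_add₃_le).trans_lt ?_
    linarith
  · refine op_ext_tensor fun t t' => ?_
    rw [hP _ (h₁.prod h₂), tensorMeasure_prod _ _ _ _ h₁ h₂, opTensor,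
      ContinuousLinearMap.completion_apply_coe, UniformSpace.Completion.inner_coe]

/-- The joint measurement of Alice and Bob given by `M(B₁ × B₂) = M₁(B₁) ⊗ M₂(B₂)`. This determines
the operators `M(B)` for all measurable `B ⊆ Ω₁ × Ω₂`. -/
noncomputable def joint : POVM (Ω₁ × Ω₂) (HilbertTensor H₁ H₂) :=
  (exists_joint M₁ M₂).choose

theorem joint_isJointMeasurement : (joint M₁ M₂).IsJointMeasurement M₁ M₂ :=
  (exists_joint M₁ M₂).choose_spec

end Existence

/-- The expectation value `∫ λ₁ λ₂ tr[ρ (M₁(dλ₁) ⊗ M₂(dλ₂))]` of the product of the real outcomes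
`λ₁ ∈ Λ₁` of Alice and `λ₂ ∈ Λ₂` of Bob in the state `ρ`. -/
noncomputable def productExpectation {Λ₁ Λ₂ : Set ℝ} [CompleteSpace H₁] [CompleteSpace H₂]
    (ρ : DensityOperator (HilbertTensor H₁ H₂)) (M₁ : POVM Λ₁ H₁) (M₂ : POVM Λ₂ H₂) : ℝ :=
  ∫ p, (p.1 : ℝ) * (p.2 : ℝ) ∂(law ρ (joint M₁ M₂))

end Joint

end POVM

/-! ### Sums over Hilbert bases -/

namespace HilbertBasis

variable {ι κ H K : Type*} [NormedAddCommGroup H] [InnerProductSpace ℂ H]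
  [NormedAddCommGroup K] [InnerProductSpace ℂ K]

/-! A positive source-operator is itself a state: its trace is the trace of its partial trace `ρ`,
hence one. Suppose it acts on `H₁ ⊗ H₁ ⊗ H₂`. Both measurements of Alice can then be performed
together, one on each copy of `H₁`, with Bob measuring `b_m` on the third factor. For each `m` this
yields a genuine probability measure `μ_m` on triples of outcomes. Since both partial traces equal
`ρ`, its two Alice–Bob marginals are the outcome distributions of `(a₁, b_m)` and `(a₂, b_m)` in
`ρ`. Its Alice–Alice marginal `κ` does not depend on `m`, because Bob's total effect is the identity
for every setting. Writing `u`, `v` for the outcomes of Alice and `w`, `w'` for those of Bob, the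
CHSH expression is `∫ (u + v) w dμ₁ + ∫ (u - v) w' dμ₂`. As `|w|, |w'| ≤ 1`, it is bounded by `∫ (|u
+ v| + |u - v|) dκ ≤ 2`. No joint distribution of all four outcomes is needed. On `H₁ ⊗ H₂ ⊗ H₂` the
roles of Alice and Bob are exchanged.

The analytic work lies in the marginals. By equality of the Hilbert–Schmidt norms of an operator and
its adjoint, `tr[ρ R²] = tr[R ρ R]` for self-adjoint `R`, in any basis. Taking `R` to be a tensor
product of square roots of effects and a product basis, `law_joint_prod` and `law_joint_prod₃`
express probabilities of boxes through diagonal matrix elements at elementary tensors, which is what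
the partial trace conditions control. All sums have terms in `[0, ∞]`, so they may be reordered
freely. -/

theorem tsum_enorm_inner_sq (e : HilbertBasis ι ℂ H) (x : H) :
    ∑' i, ‖⟪e i, x⟫_ℂ‖ₑ ^ 2 = ‖x‖ₑ ^ 2 := by
  have h : HasSum (fun i => ‖⟪e i, x⟫_ℂ‖ ^ 2) (‖x‖ ^ 2) := by
    have := Complex.reCLM.hasSum (e.hasSum_inner_mul_inner x x)
    convert this using 1
    · ext i
      rw [← inner_conj_symm x (e i), Complex.conj_mul']
      norm_cast
    · simp [← inner_self_eq_norm_sq (𝕜 := ℂ)]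
  have h' := ENNReal.ofReal_tsum_of_nonneg (fun i => sq_nonneg ‖⟪e i, x⟫_ℂ‖) h.summable
  rw [h.tsum_eq] at h'
  simpa [ENNReal.ofReal_pow, ofReal_norm] using h'.symm

/-- The Hilbert-Schmidt norms of an operator and of its adjoint agree. -/
theorem tsum_enorm_apply_sq [CompleteSpace H] (e : HilbertBasis ι ℂ H) (f : HilbertBasis κ ℂ H)
    (X : H →L[ℂ] H) : ∑' j, ‖X (f j)‖ₑ ^ 2 = ∑' i, ‖X.adjoint (e i)‖ₑ ^ 2 := by
  -- By Parseval both sides are the double sum of the squared absolute values of the matrix elements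
  -- of `X` between `e` and `f`.
  simp_rw [← e.tsum_enorm_inner_sq (X _), ← f.tsum_enorm_inner_sq (X.adjoint _)]
  rw [ENNReal.tsum_comm]
  refine tsum_congr fun i => tsum_congr fun j => ?_
  rw [ContinuousLinearMap.adjoint_inner_right, ← inner_conj_symm, RCLike.enorm_conj]

/-- The product basis of a Hilbert space tensor product. -/
theorem exists_pureTensor (e : HilbertBasis ι ℂ H) (f : HilbertBasis κ ℂ K) :
    ∃ b : HilbertBasis (ι × κ) ℂ (HilbertTensor H K), ∀ p, b p = pureTensor (e p.1) (f p.2) := by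
  classical
  have hv : Orthonormal ℂ fun p : ι × κ => pureTensor (e p.1) (f p.2) := by
    rw [orthonormal_iff_ite]
    rintro ⟨i, j⟩ ⟨i', j'⟩
    simp only [pureTensor, UniformSpace.Completion.inner_coe, TensorProduct.inner_tmul,
      orthonormal_iff_ite.1 e.orthonormal, orthonormal_iff_ite.1 f.orthonormal, Prod.mk.injEq]
    split_ifs <;> simp_all
  refine ⟨HilbertBasis.mkOfOrthogonalEqBot hv ?_, fun p => by
    rw [HilbertBasis.coe_mkOfOrthogonalEqBot]⟩
  -- Completeness: a vector orthogonal to all `e i ⊗ f j` is orthogonal to every elementary tensor,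
  -- by continuity in one slot and then in the other, and finally to the whole completion by
  -- linearity and density.
  rw [eq_bot_iff]
  intro z hz
  rw [Submodule.mem_orthogonal'] at hz
  have h₁ (i : ι) (j : κ) : ⟪z, pureTensor (e i) (f j)⟫_ℂ = 0 :=
    hz _ (Submodule.subset_span ⟨(i, j), rfl⟩)
  have h₂ (i : ι) (y : K) : ⟪z, pureTensor (e i) y⟫_ℂ = 0 := by
    have := ContinuousLinearMap.ext_on
      (f := (innerSL ℂ z) ∘L UniformSpace.Completion.toComplL ∘L TensorProduct.mkL ℂ H K (e i))
      (g := 0) (Submodule.dense_iff_topologicalClosure_eq_top.2 f.dense_span)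
      (by rintro _ ⟨j, rfl⟩; exact h₁ i j)
    exact congrArg (fun F : K →L[ℂ] ℂ => F y) this
  have h₃ (x : H) (y : K) : ⟪z, pureTensor x y⟫_ℂ = 0 := by
    have := ContinuousLinearMap.ext_on
      (f := (innerSL ℂ z) ∘L UniformSpace.Completion.toComplL ∘L (TensorProduct.mkL ℂ H K).flip y)
      (g := 0) (Submodule.dense_iff_topologicalClosure_eq_top.2 e.dense_span)
      (by rintro _ ⟨i, rfl⟩; exact h₂ i y)
    exact congrArg (fun F : H →L[ℂ] ℂ => F x) this
  refine (Submodule.mem_bot ℂ).2 (ext_inner_right ℂ fun w => ?_)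
  rw [inner_zero_left]
  induction w using UniformSpace.Completion.induction_on with
  | hp => exact isClosed_eq (by fun_prop) (by fun_prop)
  | ih t =>
    induction t using TensorProduct.induction_on with
    | zero => rw [UniformSpace.Completion.coe_zero, inner_zero_right]
    | tmul x y => exact h₃ x y
    | add a b ha hb => rw [UniformSpace.Completion.coe_add, inner_add_right, ha, hb, add_zero]

end HilbertBasis

/-! ### Positive operators -/

section Positive

variable {ι κ H : Type*} [NormedAddCommGroup H] [InnerProductSpace ℂ H] [CompleteSpace H]

theorem IsSelfAdjoint.inner_apply_left {R : H →L[ℂ] H} (hR : IsSelfAdjoint R) (x y : H) :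
    ⟪R x, y⟫_ℂ = ⟪x, R y⟫_ℂ :=
  (ContinuousLinearMap.isSelfAdjoint_iff_isSymmetric.1 hR) x y

theorem ofReal_re_inner_self_apply_mul_self {R : H →L[ℂ] H} (hR : IsSelfAdjoint R) (x : H) :
    ENNReal.ofReal (⟪x, (R * R) x⟫_ℂ).re = ‖R x‖ₑ ^ 2 := by
  have : (⟪R x, R x⟫_ℂ).re = ‖R x‖ ^ 2 := inner_self_eq_norm_sq (𝕜 := ℂ) _
  rw [mul_apply_eq_comp, ← hR.inner_apply_left, this, ENNReal.ofReal_pow (norm_nonneg _),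
    ofReal_norm]

theorem ContinuousLinearMap.IsPositive.sqrt_mul_sqrt {T : H →L[ℂ] H} (hT : T.IsPositive) :
    CFC.sqrt T * CFC.sqrt T = T :=
  CFC.sqrt_mul_sqrt_self T ((ContinuousLinearMap.nonneg_iff_isPositive T).2 hT)

theorem isSelfAdjoint_sqrt (T : H →L[ℂ] H) : IsSelfAdjoint (CFC.sqrt T) :=
  IsSelfAdjoint.of_nonneg (CFC.sqrt_nonneg T)

/-- `tr[√T R² √T] = tr[R T R]`, the traces being computed in arbitrary bases. -/
theorem ContinuousLinearMap.IsPositive.tsum_sqrt_mul_self_sqrt {T : H →L[ℂ] H}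
    (hT : T.IsPositive) {R : H →L[ℂ] H} (hR : IsSelfAdjoint R)
    (e : HilbertBasis ι ℂ H) (f : HilbertBasis κ ℂ H) :
    ∑' i, ENNReal.ofReal (⟪CFC.sqrt T (e i), (R * R) (CFC.sqrt T (e i))⟫_ℂ).re =
      ∑' j, ENNReal.ofReal (⟪R (f j), T (R (f j))⟫_ℂ).re := by
  have hS := isSelfAdjoint_sqrt T
  conv_rhs => rw [← hT.sqrt_mul_sqrt]
  simp_rw [ofReal_re_inner_self_apply_mul_self hR, ofReal_re_inner_self_apply_mul_self hS]
  -- The two sides are the squared Hilbert–Schmidt norms of `R √T` in the basis `e` and of its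
  -- adjoint `√T R` in the basis `f`.
  have := f.tsum_enorm_apply_sq e (R * CFC.sqrt T)
  rw [← ContinuousLinearMap.star_eq_adjoint, star_mul, hR.star_eq, hS.star_eq] at this
  exact this

/-- The trace of a positive operator does not depend on the basis. -/
theorem ContinuousLinearMap.IsPositive.tsum_inner_apply {T : H →L[ℂ] H} (hT : T.IsPositive)
    (e : HilbertBasis ι ℂ H) (f : HilbertBasis κ ℂ H) :
    ∑' i, ENNReal.ofReal (⟪e i, T (e i)⟫_ℂ).re = ∑' j, ENNReal.ofReal (⟪f j, T (f j)⟫_ℂ).re := by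
  -- For `R = 1` the left-hand side, the sum of `‖√T (e i)‖²`, involves only `e`, so it links the
  -- two bases.
  have h₁ := hT.tsum_sqrt_mul_self_sqrt (.one _) e e
  have h₂ := hT.tsum_sqrt_mul_self_sqrt (.one _) e f
  exact h₁.symm.trans h₂

theorem IsTraceClass.hasSum_trace {T : H →L[ℂ] H} (hT : T.IsPositive) (h : IsTraceClass T) :
    HasSum (fun i => ⟪stdBasis H i, T (stdBasis H i)⟫_ℂ) (trace T) := by
  rw [IsTraceClass, CFC.abs_of_nonneg T ((ContinuousLinearMap.nonneg_iff_isPositive T).2 hT)] at h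
  exact h.hasSum

theorem IsTraceClass.tsum_ofReal_inner {T : H →L[ℂ] H} (hT : T.IsPositive) (h : IsTraceClass T) :
    ∑' i, ENNReal.ofReal (⟪stdBasis H i, T (stdBasis H i)⟫_ℂ).re =
      ENNReal.ofReal (trace T).re := by
  have := Complex.reCLM.hasSum (h.hasSum_trace hT)
  exact (ENNReal.ofReal_tsum_of_nonneg (fun i => hT.re_inner_nonneg_right _)
    this.summable).symm.trans (congrArg _ this.tsum_eq)

theorem IsTraceClass.ofReal_re_trace {T : H →L[ℂ] H} (hT : T.IsPositive) (h : IsTraceClass T) :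
    (((trace T).re : ℝ) : ℂ) = trace T := by
  refine Complex.ext rfl ?_
  have h' := Complex.imCLM.hasSum (h.hasSum_trace hT)
  have hz (i) : Complex.imCLM ⟪stdBasis H i, T (stdBasis H i)⟫_ℂ = 0 := by
    simpa using hT.isSymmetric.im_inner_self_apply (stdBasis H i)
  simp only [hz] at h'
  simpa using hasSum_zero.unique h'

end Positive

/-! ### Outcome probabilities in an arbitrary basis -/

namespace POVM

variable {ι Ω H : Type*} [MeasurableSpace Ω] [NormedAddCommGroup H] [InnerProductSpace ℂ H]
  [CompleteSpace H]

theorem law_eq_ofReal_trace (ρ : DensityOperator H) (M : POVM Ω H) {B : Set Ω}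
    (hB : MeasurableSet B) :
    law ρ M B = ENNReal.ofReal (trace (ρ.op ∘L M.effect B)).re := by
  rw [law, Measure.ofMeasurable_apply _ hB]

/-- Cyclicity of the trace in the form `tr[√ρ R² √ρ] = tr[R ρ R]`. Any self-adjoint `R` with square
the effect is allowed, so a tensor product of square roots need not be identified as the square root
of the tensor product. The free basis `f` will be a product basis. -/
theorem law_eq_tsum (ρ : DensityOperator H) (M : POVM Ω H) {B : Set Ω} (hB : MeasurableSet B)
    {R : H →L[ℂ] H} (hR : IsSelfAdjoint R) (h : M.effect B = R * R) (f : HilbertBasis ι ℂ H) :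
    law ρ M B = ∑' j, ENNReal.ofReal (⟪R (f j), ρ.op (R (f j))⟫_ℂ).re := by
  rw [law_eq_ofReal_trace ρ M hB, ← (M.hasSum_re_sqrtOp ρ).tsum_eq,
    ENNReal.ofReal_tsum_of_nonneg (fun i => M.re_inner_effect_nonneg hB _)
      (M.hasSum_re_sqrtOp ρ).summable, h]
  exact ρ.isPositive.tsum_sqrt_mul_self_sqrt hR (stdBasis H) f

instance (ρ : DensityOperator H) (M : POVM Ω H) : IsProbabilityMeasure (law ρ M) := by
  refine ⟨?_⟩
  rw [law_eq_ofReal_trace ρ M MeasurableSet.univ, M.effect_univ]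
  have : ρ.op ∘L (1 : H →L[ℂ] H) = ρ.op := mul_one ρ.op
  rw [this, ρ.trace_eq_one]
  simp

end POVM

/-! ### Tensor products of operators -/

section OpTensor

variable {H K : Type*} [NormedAddCommGroup H] [InnerProductSpace ℂ H]
  [NormedAddCommGroup K] [InnerProductSpace ℂ K]

/-- Needed to write `M₁(B₁) ⊗ M₂(B₂)` as the square of `√M₁(B₁) ⊗ √M₂(B₂)`. -/
theorem opTensor_mul (A A' : H →L[ℂ] H) (B B' : K →L[ℂ] K) :
    opTensor (A * A') (B * B') = opTensor A B * opTensor A' B' :=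
  POVM.op_ext_tensor fun t t' => by
    simp only [opTensor, TensorProduct.mapL_mul, mul_apply_eq_comp,
      ContinuousLinearMap.completion_apply_coe]

theorem isSelfAdjoint_opTensor [CompleteSpace H] [CompleteSpace K] {A : H →L[ℂ] H}
    {B : K →L[ℂ] K} (hA : IsSelfAdjoint A) (hB : IsSelfAdjoint B) :
    IsSelfAdjoint (opTensor A B) := by
  rw [ContinuousLinearMap.isSelfAdjoint_iff_isSymmetric]
  intro z w
  change ⟪opTensor A B z, w⟫_ℂ = ⟪z, opTensor A B w⟫_ℂ
  induction z, w using UniformSpace.Completion.induction_on₂ with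
  | hp => exact isClosed_eq (by fun_prop) (by fun_prop)
  | ih t t' =>
    simp only [opTensor, ContinuousLinearMap.completion_apply_coe,
      UniformSpace.Completion.inner_coe]
    induction t using TensorProduct.induction_on with
    | zero => simp
    | add a b ha hb => rw [map_add, inner_add_left, inner_add_left, ha, hb]
    | tmul x y =>
      induction t' using TensorProduct.induction_on with
      | zero => simp
      | add a b ha hb => rw [map_add, inner_add_right, inner_add_right, ha, hb]
      | tmul x' y' => simp [hA.inner_apply_left, hB.inner_apply_left]

end OpTensor

/-! ### Traces and partial traces of positive operators -/

section PartialTrace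

variable {ι κ H K L : Type*} [NormedAddCommGroup H] [InnerProductSpace ℂ H] [CompleteSpace H]
  [NormedAddCommGroup K] [InnerProductSpace ℂ K] [NormedAddCommGroup L] [InnerProductSpace ℂ L]

theorem tsum_ofReal_re_of_hasSum {E : Type*} [NormedAddCommGroup E] [InnerProductSpace ℂ E]
    {T : E →L[ℂ] E} (hT : T.IsPositive) {v : ι → E} {c : ℂ}
    (h : HasSum (fun i => ⟪v i, T (v i)⟫_ℂ) c) :
    ∑' i, ENNReal.ofReal (⟪v i, T (v i)⟫_ℂ).re = ENNReal.ofReal c.re := by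
  have := Complex.reCLM.hasSum h
  exact (ENNReal.ofReal_tsum_of_nonneg (fun i => hT.re_inner_nonneg_right _)
    this.summable).symm.trans (congrArg _ this.tsum_eq)

/-- The diagonal case of the defining identity, summed over `q`. The families `u` and `v` are
arbitrary because they will be images of basis vectors under square roots of effects; with the bases
themselves the identity compares the traces of `T` and `σ`. -/
theorem IsPartialTraceFirst.tsum_inner
    {T : HilbertTensor H (HilbertTensor K L) →L[ℂ] HilbertTensor H (HilbertTensor K L)}
    {σ : HilbertTensor K L →L[ℂ] HilbertTensor K L} (h : IsPartialTraceFirst T σ)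
    (hT : T.IsPositive) (u : ι → K) (v : κ → L) :
    ∑' p : basisIndex H × ι × κ, ENNReal.ofReal
        (⟪pureTensor (stdBasis H p.1) (pureTensor (u p.2.1) (v p.2.2)),
          T (pureTensor (stdBasis H p.1) (pureTensor (u p.2.1) (v p.2.2)))⟫_ℂ).re =
      ∑' q : ι × κ, ENNReal.ofReal
        (⟪pureTensor (u q.1) (v q.2), σ (pureTensor (u q.1) (v q.2))⟫_ℂ).re := by
  rw [ENNReal.tsum_prod', ENNReal.tsum_comm]
  exact tsum_congr fun q => tsum_ofReal_re_of_hasSum hT (h (u q.1) (u q.1) (v q.2) (v q.2))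

theorem IsPartialTraceSecond.tsum_inner
    {T : HilbertTensor K (HilbertTensor H L) →L[ℂ] HilbertTensor K (HilbertTensor H L)}
    {σ : HilbertTensor K L →L[ℂ] HilbertTensor K L} (h : IsPartialTraceSecond T σ)
    (hT : T.IsPositive) (u : ι → K) (v : κ → L) :
    ∑' p : ι × basisIndex H × κ, ENNReal.ofReal
        (⟪pureTensor (u p.1) (pureTensor (stdBasis H p.2.1) (v p.2.2)),
          T (pureTensor (u p.1) (pureTensor (stdBasis H p.2.1) (v p.2.2)))⟫_ℂ).re =
      ∑' q : ι × κ, ENNReal.ofReal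
        (⟪pureTensor (u q.1) (v q.2), σ (pureTensor (u q.1) (v q.2))⟫_ℂ).re := by
  rw [ENNReal.tsum_prod', ENNReal.tsum_prod']
  refine tsum_congr fun i => ?_
  rw [ENNReal.tsum_prod', ENNReal.tsum_comm]
  exact tsum_congr fun k => tsum_ofReal_re_of_hasSum hT (h (u i) (u i) (v k) (v k))

theorem IsPartialTraceThird.tsum_inner
    {T : HilbertTensor K (HilbertTensor L H) →L[ℂ] HilbertTensor K (HilbertTensor L H)}
    {σ : HilbertTensor K L →L[ℂ] HilbertTensor K L} (h : IsPartialTraceThird T σ)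
    (hT : T.IsPositive) (u : ι → K) (v : κ → L) :
    ∑' p : ι × κ × basisIndex H, ENNReal.ofReal
        (⟪pureTensor (u p.1) (pureTensor (v p.2.1) (stdBasis H p.2.2)),
          T (pureTensor (u p.1) (pureTensor (v p.2.1) (stdBasis H p.2.2)))⟫_ℂ).re =
      ∑' q : ι × κ, ENNReal.ofReal
        (⟪pureTensor (u q.1) (v q.2), σ (pureTensor (u q.1) (v q.2))⟫_ℂ).re := by
  rw [ENNReal.tsum_prod', ENNReal.tsum_prod']
  refine tsum_congr fun i => ?_
  rw [ENNReal.tsum_prod']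
  exact tsum_congr fun k => tsum_ofReal_re_of_hasSum hT (h (u i) (u i) (v k) (v k))

variable [CompleteSpace K] [CompleteSpace L]

theorem IsTraceClass.ofReal_re_trace_prod {T : HilbertTensor H K →L[ℂ] HilbertTensor H K}
    (hT : T.IsPositive) (h : IsTraceClass T) :
    ENNReal.ofReal (trace T).re = ∑' p : basisIndex H × basisIndex K, ENNReal.ofReal
      (⟪pureTensor (stdBasis H p.1) (stdBasis K p.2),
        T (pureTensor (stdBasis H p.1) (stdBasis K p.2))⟫_ℂ).re := by
  obtain ⟨b, hb⟩ := (stdBasis H).exists_pureTensor (stdBasis K)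
  simp_rw [← hb]
  rw [← h.tsum_ofReal_inner hT]
  exact hT.tsum_inner_apply _ b

theorem IsTraceClass.ofReal_re_trace_prod₃
    {T : HilbertTensor H (HilbertTensor K L) →L[ℂ] HilbertTensor H (HilbertTensor K L)}
    (hT : T.IsPositive) (h : IsTraceClass T) :
    ENNReal.ofReal (trace T).re =
      ∑' p : basisIndex H × basisIndex K × basisIndex L, ENNReal.ofReal
        (⟪pureTensor (stdBasis H p.1) (pureTensor (stdBasis K p.2.1) (stdBasis L p.2.2)),
          T (pureTensor (stdBasis H p.1)
            (pureTensor (stdBasis K p.2.1) (stdBasis L p.2.2)))⟫_ℂ).re := by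
  obtain ⟨b, hb⟩ := (stdBasis K).exists_pureTensor (stdBasis L)
  obtain ⟨c, hc⟩ := (stdBasis H).exists_pureTensor b
  simp_rw [← hb, ← hc]
  rw [← h.tsum_ofReal_inner hT]
  exact hT.tsum_inner_apply _ c

/-- Although `ENNReal.ofReal` truncates negative numbers, the value 1 determines the real part, and
the trace of a positive operator is real. -/
theorem IsTraceClass.trace_eq_one {T : H →L[ℂ] H} (hT : T.IsPositive) (h : IsTraceClass T)
    (h₁ : ENNReal.ofReal (trace T).re = 1) : trace T = 1 := by
  rw [ENNReal.ofReal_eq_one] at h₁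
  rw [← h.ofReal_re_trace hT, h₁, Complex.ofReal_one]

theorem DensityOperator.tsum_inner_pureTensor (ρ : DensityOperator (HilbertTensor H K)) :
    ∑' p : basisIndex H × basisIndex K, ENNReal.ofReal
      (⟪pureTensor (stdBasis H p.1) (stdBasis K p.2),
        ρ.op (pureTensor (stdBasis H p.1) (stdBasis K p.2))⟫_ℂ).re = 1 := by
  rw [← ρ.isTraceClass.ofReal_re_trace_prod ρ.isPositive, ρ.trace_eq_one]
  simp

end PartialTrace

/-! ### Marginals of the outcome distribution -/

namespace POVM

variable {H K L : Type*} [NormedAddCommGroup H] [InnerProductSpace ℂ H] [CompleteSpace H]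
  [NormedAddCommGroup K] [InnerProductSpace ℂ K] [CompleteSpace K]
  [NormedAddCommGroup L] [InnerProductSpace ℂ L] [CompleteSpace L]
  {Ω Ω₁ Ω₂ Ω₃ : Type*} [MeasurableSpace Ω] [MeasurableSpace Ω₁] [MeasurableSpace Ω₂]
  [MeasurableSpace Ω₃]

/-- This is `tr[R ρ R]` for `R = √M₁(B₁) ⊗ √M₂(B₂)` in the product basis. Only elementary tensors
occur, so partial trace conditions apply directly. -/
theorem law_joint_prod (ρ : DensityOperator (HilbertTensor H K)) (M₁ : POVM Ω₁ H)
    (M₂ : POVM Ω₂ K) {B₁ : Set Ω₁} {B₂ : Set Ω₂}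
    (h₁ : MeasurableSet B₁) (h₂ : MeasurableSet B₂) :
    law ρ (joint M₁ M₂) (B₁ ×ˢ B₂) = ∑' p : basisIndex H × basisIndex K, ENNReal.ofReal
      (⟪pureTensor (CFC.sqrt (M₁.effect B₁) (stdBasis H p.1))
          (CFC.sqrt (M₂.effect B₂) (stdBasis K p.2)),
        ρ.op (pureTensor (CFC.sqrt (M₁.effect B₁) (stdBasis H p.1))
          (CFC.sqrt (M₂.effect B₂) (stdBasis K p.2)))⟫_ℂ).re := by
  obtain ⟨b, hb⟩ := (stdBasis H).exists_pureTensor (stdBasis K)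
  rw [law_eq_tsum ρ _ (h₁.prod h₂) (isSelfAdjoint_opTensor (isSelfAdjoint_sqrt (M₁.effect B₁))
    (isSelfAdjoint_sqrt (M₂.effect B₂))) _ b]
  · simp_rw [hb, opTensor_pureTensor]
  · rw [← opTensor_mul, (M₁.isPositive _ h₁).sqrt_mul_sqrt, (M₂.isPositive _ h₂).sqrt_mul_sqrt]
    exact joint_isJointMeasurement M₁ M₂ _ _ h₁ h₂

theorem law_joint_prod₃ (ρ : DensityOperator (HilbertTensor H (HilbertTensor K L)))
    (M₁ : POVM Ω₁ H) (M₂ : POVM Ω₂ K) (M₃ : POVM Ω₃ L) {B₁ : Set Ω₁} {B₂ : Set Ω₂} {B₃ : Set Ω₃}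
    (h₁ : MeasurableSet B₁) (h₂ : MeasurableSet B₂) (h₃ : MeasurableSet B₃) :
    law ρ (joint M₁ (joint M₂ M₃)) (B₁ ×ˢ B₂ ×ˢ B₃) =
      ∑' p : basisIndex H × basisIndex K × basisIndex L, ENNReal.ofReal
        (⟪pureTensor (CFC.sqrt (M₁.effect B₁) (stdBasis H p.1))
            (pureTensor (CFC.sqrt (M₂.effect B₂) (stdBasis K p.2.1))
              (CFC.sqrt (M₃.effect B₃) (stdBasis L p.2.2))),
          ρ.op (pureTensor (CFC.sqrt (M₁.effect B₁) (stdBasis H p.1))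
            (pureTensor (CFC.sqrt (M₂.effect B₂) (stdBasis K p.2.1))
              (CFC.sqrt (M₃.effect B₃) (stdBasis L p.2.2))))⟫_ℂ).re := by
  obtain ⟨b, hb⟩ := (stdBasis K).exists_pureTensor (stdBasis L)
  obtain ⟨c, hc⟩ := (stdBasis H).exists_pureTensor b
  rw [law_eq_tsum ρ _ (h₁.prod (h₂.prod h₃))
    (isSelfAdjoint_opTensor (isSelfAdjoint_sqrt (M₁.effect B₁))
      (isSelfAdjoint_opTensor (isSelfAdjoint_sqrt (M₂.effect B₂))
        (isSelfAdjoint_sqrt (M₃.effect B₃)))) _ c]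
  · simp_rw [hc, hb, opTensor_pureTensor]
  · rw [← opTensor_mul, ← opTensor_mul, (M₁.isPositive _ h₁).sqrt_mul_sqrt,
      (M₂.isPositive _ h₂).sqrt_mul_sqrt, (M₃.isPositive _ h₃).sqrt_mul_sqrt,
      ← joint_isJointMeasurement M₂ M₃ _ _ h₂ h₃]
    exact joint_isJointMeasurement M₁ (joint M₂ M₃) _ _ h₁ (h₂.prod h₃)

theorem sqrt_effect_univ_apply (M : POVM Ω H) (x : H) : CFC.sqrt (M.effect Set.univ) x = x := by
  rw [M.effect_univ, CFC.sqrt_one]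
  rfl

/-- Rectangles determine a finite measure on a product. Over a rectangle the ignored outcome ranges
over all of `Ω`, where the effect and its square root are the identity. The traced factor thus
carries bare basis vectors, and summing over them is the partial trace. -/
theorem map_law_of_isPartialTraceFirst {τ : DensityOperator (HilbertTensor H (HilbertTensor K L))}
    {σ : DensityOperator (HilbertTensor K L)} (h : IsPartialTraceFirst τ.op σ.op)
    (M : POVM Ω H) (M₁ : POVM Ω₁ K) (M₂ : POVM Ω₂ L) :
    (law τ (joint M (joint M₁ M₂))).map Prod.snd = law σ (joint M₁ M₂) := by
  refine Measure.ext_prod fun {B₁ B₂} h₁ h₂ => ?_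
  have e : Prod.snd ⁻¹' (B₁ ×ˢ B₂) = (Set.univ : Set Ω) ×ˢ B₁ ×ˢ B₂ := by ext; simp
  rw [Measure.map_apply (by fun_prop) (h₁.prod h₂), e, law_joint_prod₃ _ _ _ _ .univ h₁ h₂,
    law_joint_prod _ _ _ h₁ h₂]
  simp_rw [sqrt_effect_univ_apply]
  exact h.tsum_inner τ.isPositive (fun i => CFC.sqrt (M₁.effect B₁) (stdBasis K i))
    (fun j => CFC.sqrt (M₂.effect B₂) (stdBasis L j))

theorem map_law_of_isPartialTraceSecond {τ : DensityOperator (HilbertTensor K (HilbertTensor H L))}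
    {σ : DensityOperator (HilbertTensor K L)} (h : IsPartialTraceSecond τ.op σ.op)
    (M : POVM Ω H) (M₁ : POVM Ω₁ K) (M₂ : POVM Ω₂ L) :
    (law τ (joint M₁ (joint M M₂))).map (fun p => (p.1, p.2.2)) = law σ (joint M₁ M₂) := by
  refine Measure.ext_prod fun {B₁ B₂} h₁ h₂ => ?_
  have e : (fun p : Ω₁ × Ω × Ω₂ => (p.1, p.2.2)) ⁻¹' (B₁ ×ˢ B₂) =
      B₁ ×ˢ (Set.univ : Set Ω) ×ˢ B₂ := by ext; simp
  rw [Measure.map_apply (by fun_prop) (h₁.prod h₂), e, law_joint_prod₃ _ _ _ _ h₁ .univ h₂,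
    law_joint_prod _ _ _ h₁ h₂]
  simp_rw [sqrt_effect_univ_apply]
  exact h.tsum_inner τ.isPositive (fun i => CFC.sqrt (M₁.effect B₁) (stdBasis K i))
    (fun j => CFC.sqrt (M₂.effect B₂) (stdBasis L j))

theorem map_law_of_isPartialTraceThird {τ : DensityOperator (HilbertTensor K (HilbertTensor L H))}
    {σ : DensityOperator (HilbertTensor K L)} (h : IsPartialTraceThird τ.op σ.op)
    (M : POVM Ω H) (M₁ : POVM Ω₁ K) (M₂ : POVM Ω₂ L) :
    (law τ (joint M₁ (joint M₂ M))).map (fun p => (p.1, p.2.1)) = law σ (joint M₁ M₂) := by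
  refine Measure.ext_prod fun {B₁ B₂} h₁ h₂ => ?_
  have e : (fun p : Ω₁ × Ω₂ × Ω => (p.1, p.2.1)) ⁻¹' (B₁ ×ˢ B₂) =
      B₁ ×ˢ B₂ ×ˢ (Set.univ : Set Ω) := by ext; simp
  rw [Measure.map_apply (by fun_prop) (h₁.prod h₂), e, law_joint_prod₃ _ _ _ _ h₁ h₂ .univ,
    law_joint_prod _ _ _ h₁ h₂]
  simp_rw [sqrt_effect_univ_apply]
  exact h.tsum_inner τ.isPositive (fun i => CFC.sqrt (M₁.effect B₁) (stdBasis K i))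
    (fun j => CFC.sqrt (M₂.effect B₂) (stdBasis L j))

/-- The joint distribution of the first two outcomes is independent of the third measurement. -/
theorem map_law_third_eq (τ : DensityOperator (HilbertTensor H (HilbertTensor K L)))
    (M₁ : POVM Ω₁ H) (M₂ : POVM Ω₂ K) (M : POVM Ω L) (M' : POVM Ω₃ L) :
    (law τ (joint M₁ (joint M₂ M))).map (fun p => (p.1, p.2.1)) =
      (law τ (joint M₁ (joint M₂ M'))).map (fun p => (p.1, p.2.1)) := by
  refine Measure.ext_prod fun {B₁ B₂} h₁ h₂ => ?_
  have e : (fun p : Ω₁ × Ω₂ × Ω => (p.1, p.2.1)) ⁻¹' (B₁ ×ˢ B₂) =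
      B₁ ×ˢ B₂ ×ˢ (Set.univ : Set Ω) := by ext; simp
  have e' : (fun p : Ω₁ × Ω₂ × Ω₃ => (p.1, p.2.1)) ⁻¹' (B₁ ×ˢ B₂) =
      B₁ ×ˢ B₂ ×ˢ (Set.univ : Set Ω₃) := by ext; simp
  rw [Measure.map_apply (by fun_prop) (h₁.prod h₂), Measure.map_apply (by fun_prop) (h₁.prod h₂),
    e, e', law_joint_prod₃ _ _ _ _ h₁ h₂ .univ, law_joint_prod₃ _ _ _ _ h₁ h₂ .univ]
  -- Once the total effects of `M` and `M'` have become the identity, both sides are the same sum.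
  simp_rw [sqrt_effect_univ_apply]

/-- The joint distribution of the last two outcomes is independent of the first measurement. -/
theorem map_law_first_eq (τ : DensityOperator (HilbertTensor H (HilbertTensor K L)))
    (M : POVM Ω H) (M' : POVM Ω₃ H) (M₁ : POVM Ω₁ K) (M₂ : POVM Ω₂ L) :
    (law τ (joint M (joint M₁ M₂))).map Prod.snd =
      (law τ (joint M' (joint M₁ M₂))).map Prod.snd := by
  refine Measure.ext_prod fun {B₁ B₂} h₁ h₂ => ?_
  have e : Prod.snd ⁻¹' (B₁ ×ˢ B₂) = (Set.univ : Set Ω) ×ˢ B₁ ×ˢ B₂ := by ext; simp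
  have e' : Prod.snd ⁻¹' (B₁ ×ˢ B₂) = (Set.univ : Set Ω₃) ×ˢ B₁ ×ˢ B₂ := by ext; simp
  rw [Measure.map_apply (by fun_prop) (h₁.prod h₂), Measure.map_apply (by fun_prop) (h₁.prod h₂),
    e, e', law_joint_prod₃ _ _ _ _ .univ h₁ h₂, law_joint_prod₃ _ _ _ _ .univ h₁ h₂]
  simp_rw [sqrt_effect_univ_apply]

end POVM

/-! ### The CHSH inequality for outcomes with a common joint distribution -/

/-- The left-hand side equals `2 * max |a| |b|`. -/
theorem abs_add_add_abs_sub_le_two {a b : ℝ} (ha : |a| ≤ 1) (hb : |b| ≤ 1) :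
    |a + b| + |a - b| ≤ 2 := by
  rw [abs_le] at ha hb
  rcases abs_cases (a + b) with h | h <;> rcases abs_cases (a - b) with h' | h' <;> linarith

theorem integrable_mul_of_abs_le_one {Ω : Type*} [MeasurableSpace Ω] {μ : Measure Ω}
    [IsFiniteMeasure μ] {f g : Ω → ℝ} (hf : Measurable f) (hg : Measurable g)
    (hf₁ : ∀ x, |f x| ≤ 1) (hg₁ : ∀ x, |g x| ≤ 1) : Integrable (fun x => f x * g x) μ :=
  .of_bound (hf.mul hg).aestronglyMeasurable 1 (.of_forall fun x => by
    rw [Real.norm_eq_abs, abs_mul]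
    exact mul_le_one₀ (hf₁ x) (abs_nonneg _) (hg₁ x))

/-- The bound depends on `p` only through `φ p`, so its integral sees only the image measure.
Integrals over different spaces thereby become comparable over a common `Z`. -/
theorem MeasureTheory.MeasurePreserving.abs_integral_le {Z Ω : Type*} [MeasurableSpace Z]
    [MeasurableSpace Ω] {κ : Measure Z} {μ : Measure Ω} {φ : Ω → Z} (hφ : MeasurePreserving φ μ κ)
    {f : Ω → ℝ} {g : Z → ℝ} (hg : Integrable g κ) (h : ∀ p, |f p| ≤ g (φ p)) :
    |∫ p, f p ∂μ| ≤ ∫ z, g z ∂κ := by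
  rw [← hφ.map_eq, integral_map hφ.aemeasurable (by rw [hφ.map_eq]; exact hg.1)]
  exact norm_integral_le_of_norm_le (f := f) (g := fun p => g (φ p))
    ((hφ.integrable_comp hg.1).2 hg) (.of_forall h)

/-- The variables `w` and `w'` may live on unrelated spaces: each is bounded away by 1 before
integrating, after which only the common marginal `κ` of the pair `(u, v)` matters. -/
theorem abs_integral_chsh_le {Z Ω Ω' : Type*} [MeasurableSpace Z] [MeasurableSpace Ω]
    [MeasurableSpace Ω'] {κ : Measure Z} [IsProbabilityMeasure κ] {μ : Measure Ω}
    [IsFiniteMeasure μ] {μ' : Measure Ω'} [IsFiniteMeasure μ']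
    {φ : Ω → Z} {φ' : Ω' → Z} (hφ : MeasurePreserving φ μ κ) (hφ' : MeasurePreserving φ' μ' κ)
    {u v : Z → ℝ} (hu : Measurable u) (hv : Measurable v) (hu₁ : ∀ z, |u z| ≤ 1)
    (hv₁ : ∀ z, |v z| ≤ 1) {w : Ω → ℝ} {w' : Ω' → ℝ} (hw : Measurable w) (hw' : Measurable w')
    (hw₁ : ∀ p, |w p| ≤ 1) (hw₁' : ∀ p, |w' p| ≤ 1) :
    |(∫ p, u (φ p) * w p ∂μ) + (∫ p, v (φ p) * w p ∂μ) + (∫ p, u (φ' p) * w' p ∂μ') -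
      ∫ p, v (φ' p) * w' p ∂μ'| ≤ 2 := by
  have hs : Integrable (fun z => |u z + v z|) κ :=
    .of_bound (hu.add hv).abs.aestronglyMeasurable 2 (.of_forall fun z => by
      rw [Real.norm_eq_abs, abs_abs]
      linarith [abs_add_add_abs_sub_le_two (hu₁ z) (hv₁ z), abs_nonneg (u z - v z)])
  have hd : Integrable (fun z => |u z - v z|) κ :=
    .of_bound (hu.sub hv).abs.aestronglyMeasurable 2 (.of_forall fun z => by
      rw [Real.norm_eq_abs, abs_abs]
      linarith [abs_add_add_abs_sub_le_two (hu₁ z) (hv₁ z), abs_nonneg (u z + v z)])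
  have b₁ : |∫ p, (u (φ p) * w p + v (φ p) * w p) ∂μ| ≤ ∫ z, |u z + v z| ∂κ :=
    hφ.abs_integral_le hs fun p => by
      rw [← add_mul, abs_mul]
      exact mul_le_of_le_one_right (abs_nonneg _) (hw₁ p)
  have b₂ : |∫ p, (u (φ' p) * w' p - v (φ' p) * w' p) ∂μ'| ≤ ∫ z, |u z - v z| ∂κ :=
    hφ'.abs_integral_le hd fun p => by
      rw [← sub_mul, abs_mul]
      exact mul_le_of_le_one_right (abs_nonneg _) (hw₁' p)
  have b : ∫ z, |u z + v z| ∂κ + ∫ z, |u z - v z| ∂κ ≤ 2 := by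
    rw [← integral_add hs hd]
    calc _ ≤ ∫ _, (2 : ℝ) ∂κ := integral_mono (hs.add hd) (integrable_const _) fun z =>
          abs_add_add_abs_sub_le_two (hu₁ z) (hv₁ z)
      _ = 2 := by simp
  rw [integral_add
    (integrable_mul_of_abs_le_one (f := fun p => u (φ p)) (hu.comp hφ.measurable) hw
      (fun _ => hu₁ _) hw₁)
    (integrable_mul_of_abs_le_one (f := fun p => v (φ p)) (hv.comp hφ.measurable) hw
      (fun _ => hv₁ _) hw₁)] at b₁
  rw [integral_sub
    (integrable_mul_of_abs_le_one (f := fun p => u (φ' p)) (hu.comp hφ'.measurable) hw'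
      (fun _ => hu₁ _) hw₁')
    (integrable_mul_of_abs_le_one (f := fun p => v (φ' p)) (hv.comp hφ'.measurable) hw'
      (fun _ => hv₁ _) hw₁')] at b₂
  rw [add_sub_assoc]
  exact (abs_add_le _ _).trans ((add_le_add b₁ b₂).trans b)

/-! ### Source-operators as states -/

section SourceOperators

variable {H₁ H₂ : Type*} [NormedAddCommGroup H₁] [InnerProductSpace ℂ H₁] [CompleteSpace H₁]
  [NormedAddCommGroup H₂] [InnerProductSpace ℂ H₂] [CompleteSpace H₂]
  {ρ : DensityOperator (HilbertTensor H₁ H₂)}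

/-- A positive source-operator on `H₁ ⊗ H₁ ⊗ H₂` is a state. -/
noncomputable def IsSourceOperator112.toDensityOperator
    {T : HilbertTensor H₁ (HilbertTensor H₁ H₂) →L[ℂ] HilbertTensor H₁ (HilbertTensor H₁ H₂)}
    (h : IsSourceOperator112 ρ T) (hT : T.IsPositive) :
    DensityOperator (HilbertTensor H₁ (HilbertTensor H₁ H₂)) where
  op := T
  isPositive := hT
  isTraceClass := h.isTraceClass
  trace_eq_one := h.isTraceClass.trace_eq_one hT <| by
    -- In a product basis, the sum over the first factor turns the trace of `T` into that of `ρ`.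
    rw [h.isTraceClass.ofReal_re_trace_prod₃ hT, ← ρ.tsum_inner_pureTensor]
    exact h.partialTrace_first.tsum_inner hT (fun i => stdBasis H₁ i) (fun j => stdBasis H₂ j)

/-- A positive source-operator on `H₁ ⊗ H₂ ⊗ H₂` is a state. -/
noncomputable def IsSourceOperator122.toDensityOperator
    {T : HilbertTensor H₁ (HilbertTensor H₂ H₂) →L[ℂ] HilbertTensor H₁ (HilbertTensor H₂ H₂)}
    (h : IsSourceOperator122 ρ T) (hT : T.IsPositive) :
    DensityOperator (HilbertTensor H₁ (HilbertTensor H₂ H₂)) where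
  op := T
  isPositive := hT
  isTraceClass := h.isTraceClass
  trace_eq_one := h.isTraceClass.trace_eq_one hT <| by
    rw [h.isTraceClass.ofReal_re_trace_prod₃ hT, ← ρ.tsum_inner_pureTensor]
    exact h.partialTrace_third.tsum_inner hT (fun i => stdBasis H₁ i) (fun j => stdBasis H₂ j)

end SourceOperators

/-! ### The CHSH inequality for the two kinds of source-operators -/

namespace POVM

variable {H₁ H₂ : Type*} [NormedAddCommGroup H₁] [InnerProductSpace ℂ H₁] [CompleteSpace H₁]
  [NormedAddCommGroup H₂] [InnerProductSpace ℂ H₂] [CompleteSpace H₂]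
  {ρ : DensityOperator (HilbertTensor H₁ H₂)}

theorem productExpectation_eq_integral {Λ₁ Λ₂ : Set ℝ} {Ω : Type*} [MeasurableSpace Ω]
    {μ : Measure Ω} {M₁ : POVM Λ₁ H₁} {M₂ : POVM Λ₂ H₂} {φ : Ω → Λ₁ × Λ₂} (hφ : Measurable φ)
    (h : μ.map φ = law ρ (joint M₁ M₂)) :
    productExpectation ρ M₁ M₂ = ∫ p, ((φ p).1 : ℝ) * ((φ p).2 : ℝ) ∂μ := by
  rw [productExpectation, ← h, integral_map hφ.aemeasurable]
  exact Measurable.aestronglyMeasurable (by fun_prop)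

variable {Λ₁ Λ₂ : Fin 2 → Set ℝ}

theorem chsh_of_isSourceOperator112
    {T : HilbertTensor H₁ (HilbertTensor H₁ H₂) →L[ℂ] HilbertTensor H₁ (HilbertTensor H₁ H₂)}
    (h : IsSourceOperator112 ρ T) (hT : T.IsPositive)
    (hΛ₁ : ∀ n, ∀ l ∈ Λ₁ n, |l| ≤ 1) (hΛ₂ : ∀ m, ∀ l ∈ Λ₂ m, |l| ≤ 1)
    (M₁ : ∀ n, POVM (Λ₁ n) H₁) (M₂ : ∀ m, POVM (Λ₂ m) H₂) :
    |productExpectation ρ (M₁ 0) (M₂ 0) + productExpectation ρ (M₁ 0) (M₂ 1) +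
      productExpectation ρ (M₁ 1) (M₂ 0) - productExpectation ρ (M₁ 1) (M₂ 1)| ≤ 2 := by
  set τ := h.toDensityOperator hT
  let μ (m : Fin 2) := law τ (joint (M₁ 0) (joint (M₁ 1) (M₂ m)))
  have e₀ (m) : productExpectation ρ (M₁ 0) (M₂ m) = ∫ p, (p.1 : ℝ) * (p.2.2 : ℝ) ∂μ m :=
    productExpectation_eq_integral (φ := fun p : Λ₁ 0 × Λ₁ 1 × Λ₂ m => (p.1, p.2.2)) (by fun_prop)
      (map_law_of_isPartialTraceSecond (τ := τ) h.partialTrace_second _ _ _)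
  have e₁ (m) : productExpectation ρ (M₁ 1) (M₂ m) = ∫ p, (p.2.1 : ℝ) * (p.2.2 : ℝ) ∂μ m :=
    productExpectation_eq_integral (φ := Prod.snd) (by fun_prop)
      (map_law_of_isPartialTraceFirst (τ := τ) h.partialTrace_first _ _ _)
  let φ (m : Fin 2) (p : Λ₁ 0 × Λ₁ 1 × Λ₂ m) : Λ₁ 0 × Λ₁ 1 := (p.1, p.2.1)
  have hφ (m) : Measurable (φ m) := by fun_prop
  have : IsProbabilityMeasure ((μ 0).map (φ 0)) := Measure.isProbabilityMeasure_map (by fun_prop)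
  have key := abs_integral_chsh_le (κ := (μ 0).map (φ 0)) (μ := μ 0) (μ' := μ 1)
    -- `κ` is by definition the Alice–Alice marginal of `μ 0`; that `μ 1` has the same one is the
    -- independence from Bob's setting.
    (φ := φ 0) (φ' := φ 1) ⟨hφ 0, rfl⟩ ⟨hφ 1, (map_law_third_eq τ _ _ _ _).symm⟩
    (u := fun z => (z.1 : ℝ)) (v := fun z => (z.2 : ℝ)) (by fun_prop) (by fun_prop)
    (fun z => hΛ₁ 0 _ z.1.2) (fun z => hΛ₁ 1 _ z.2.2)
    (w := fun p => (p.2.2 : ℝ)) (w' := fun p => (p.2.2 : ℝ)) (by fun_prop) (by fun_prop)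
    (fun p => hΛ₂ 0 _ p.2.2.2) (fun p => hΛ₂ 1 _ p.2.2.2)
  rw [e₀, e₀, e₁, e₁]
  -- `key` groups the terms by Bob's setting, so the two middle terms are interchanged.
  convert key using 2
  ring

/-- Here Bob's two outcomes share one distribution, and the setting of Alice distinguishes the two
measures. -/
theorem chsh_of_isSourceOperator122
    {T : HilbertTensor H₁ (HilbertTensor H₂ H₂) →L[ℂ] HilbertTensor H₁ (HilbertTensor H₂ H₂)}
    (h : IsSourceOperator122 ρ T) (hT : T.IsPositive)
    (hΛ₁ : ∀ n, ∀ l ∈ Λ₁ n, |l| ≤ 1) (hΛ₂ : ∀ m, ∀ l ∈ Λ₂ m, |l| ≤ 1)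
    (M₁ : ∀ n, POVM (Λ₁ n) H₁) (M₂ : ∀ m, POVM (Λ₂ m) H₂) :
    |productExpectation ρ (M₁ 0) (M₂ 0) + productExpectation ρ (M₁ 0) (M₂ 1) +
      productExpectation ρ (M₁ 1) (M₂ 0) - productExpectation ρ (M₁ 1) (M₂ 1)| ≤ 2 := by
  set τ := h.toDensityOperator hT
  let μ (n : Fin 2) := law τ (joint (M₁ n) (joint (M₂ 0) (M₂ 1)))
  have e₀ (n) : productExpectation ρ (M₁ n) (M₂ 0) = ∫ p, (p.1 : ℝ) * (p.2.1 : ℝ) ∂μ n :=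
    productExpectation_eq_integral (φ := fun p : Λ₁ n × Λ₂ 0 × Λ₂ 1 => (p.1, p.2.1)) (by fun_prop)
      (map_law_of_isPartialTraceThird (τ := τ) h.partialTrace_third _ _ _)
  have e₁ (n) : productExpectation ρ (M₁ n) (M₂ 1) = ∫ p, (p.1 : ℝ) * (p.2.2 : ℝ) ∂μ n :=
    productExpectation_eq_integral (φ := fun p : Λ₁ n × Λ₂ 0 × Λ₂ 1 => (p.1, p.2.2)) (by fun_prop)
      (map_law_of_isPartialTraceSecond (τ := τ) h.partialTrace_second _ _ _)
  have : IsProbabilityMeasure ((μ 0).map Prod.snd) := Measure.isProbabilityMeasure_map (by fun_prop)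
  have key := abs_integral_chsh_le (κ := (μ 0).map Prod.snd) (μ := μ 0) (μ' := μ 1)
    ⟨measurable_snd, rfl⟩ ⟨measurable_snd, (map_law_first_eq τ _ _ _ _).symm⟩
    (u := fun z => (z.1 : ℝ)) (v := fun z => (z.2 : ℝ)) (by fun_prop) (by fun_prop)
    (fun z => hΛ₂ 0 _ z.1.2) (fun z => hΛ₂ 1 _ z.2.2)
    (w := fun p => (p.1 : ℝ)) (w' := fun p => (p.1 : ℝ)) (by fun_prop) (by fun_prop)
    (fun p => hΛ₁ 0 _ p.1.2) (fun p => hΛ₁ 1 _ p.1.2)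
  rw [e₀, e₀, e₁, e₁]
  simpa only [mul_comm] using key

end POVM

theorem theorem5 {H₁ H₂ : Type*}
    [NormedAddCommGroup H₁] [InnerProductSpace ℂ H₁] [CompleteSpace H₁]
    [TopologicalSpace.SeparableSpace H₁]
    [NormedAddCommGroup H₂] [InnerProductSpace ℂ H₂] [CompleteSpace H₂]
    [TopologicalSpace.SeparableSpace H₂]
    (ρ : DensityOperator (HilbertTensor H₁ H₂)) (hρ : IsDSOState ρ)
    (Λ₁ Λ₂ : Fin 2 → Set ℝ)
    (hΛ₁ : ∀ n, ∀ l ∈ Λ₁ n, |l| ≤ 1) (hΛ₂ : ∀ m, ∀ l ∈ Λ₂ m, |l| ≤ 1)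
    (M₁ : ∀ n, POVM (Λ₁ n) H₁) (M₂ : ∀ m, POVM (Λ₂ m) H₂) :
    |POVM.productExpectation ρ (M₁ 0) (M₂ 0) + POVM.productExpectation ρ (M₁ 0) (M₂ 1) +
      POVM.productExpectation ρ (M₁ 1) (M₂ 0) - POVM.productExpectation ρ (M₁ 1) (M₂ 1)| ≤ 2 := by
  rcases hρ with ⟨T, h, hT⟩ | ⟨T, h, hT⟩
  · exact POVM.chsh_of_isSourceOperator112 h hT hΛ₁ hΛ₂ M₁ M₂
  · exact POVM.chsh_of_isSourceOperator122 h hT hΛ₁ hΛ₂ M₁ M₂
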